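/- **Setting.** Consider the cubic lattice in $\mathbb R^3$ as a cell complex with vertex set $\mathbb Z^3$. A *cubic polyhedron* is a set $P$ of unit squares of the lattice (its faces) forming an embedded surface whose vertices and edges are all the vertices and edges of the lattice; that is, every lattice edge lies in exactly two faces, and the faces at each lattice vertex form a single cycle. An edge is a *flange* if its two faces are coplanar and a *crease* otherwise. A vertex is a *monkey-saddle* if its six edges are creases; otherwise it is a *screw*: exactly two of its edges are flanges, and they lie in opposite directions along a coordinate axis, called the axis of the screw. A *slab* of $P$ with normal $n$ and axis $a$ (two distinct coordinate axes) is a lattice plane perpendicular to $n$ all of whose vertices are screws with axis $a$, such that the configurations of $P$ at any two vertices of this plane adjacent along the third axis are mirror images of each other. It is *untwisted* if the configurations at adjacent vertices along $a$ are mirror images as well. A *sheet* with normal $n$ is a lattice plane perpendicular to $n$ all of whose vertices are monkey-saddles, the configurations at any two adjacent vertices of the plane being mirror images. Let $P_0$ be the cubic polyhedron, unique up to isometry, all of whose vertices are monkey-saddles. For $\tau:\mathbb Z\to\{0,x,y\}$ let $P_\tau$ be the cubic polyhedron, unique up to isometry, whose vertices in the plane $z=n$ form a sheet if $\tau(n)=0$,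 and an untwisted slab with normal $z$ and axis $\tau(n)$ otherwise. A face is *normal* if its four edges are creases. A *tower* of $P$ is a $2\times2\times\mathbb Z$ box of lattice vertices, in the direction of any coordinate axis (the axis of the tower), in which $P$ is obtained by repeated reflection, along that axis, from the local configuration at the four vertices of a normal face perpendicular to the axis. To *push* a tower is to remove all faces parallel to its axis that lie within the box and to insert all lattice squares parallel to its axis that lie within the box and were not faces. A *pushed polyhedron* is a polyhedron that, for some naming $x,y,z$ of the three coordinate axes and some position of the starting polyhedron, is obtained in one of the following two ways, where each set of towers may be empty, finite or infinite: 1. start from $P_0$; push some set of its towers with axis $z$; then push some set of the towers with axis $y$ of the resulting polyhedron; then push some set of the towers with axis $x$ of the polyhedron so obtained; 2. start from some $P_\tau$; push some set of its towers with axis $y$; then push some set of the towers with axis $x$ of the resulting polyhedron. **Statement.** Every cubic polyhedron that contains no slab (with any normal and any axis, twisted or untwisted) is a pushed polyhedron. -/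

import Mathlib

namespace CubicPolyhedra

/-- The vertices of the cubic lattice. -/
abbrev Point : Type := Fin 3 → ℤ

/-- The unit vector along the `i`-th coordinate axis. -/
def unit (i : Fin 3) : Point := Pi.single i 1

/-- The six directions of the lattice edges at a vertex: an axis and a sign. -/
abbrev Dir : Type := Fin 3 × ℤˣ

/-- The unit vector in direction `d`. -/
def Dir.vec (d : Dir) : Point := Pi.single d.1 (d.2 : ℤ)

/-- The opposite direction. -/
def Dir.opp (d : Dir) : Dir := (d.1, -d.2)

/-- The reflection of directions that reverses the `i`-th axis. -/
def Dir.refl (i : Fin 3) (d : Dir) : Dir := if d.1 = i then d.opp else d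

/-- The unit squares of the cubic lattice, given by the axis normal to the square and the corner
with the smallest coordinates. -/
@[ext]
structure Square : Type where
  corner : Point
  normal : Fin 3

/-- The four corners of a square. -/
def Square.corners (f : Square) : Set Point :=
  {v | v f.normal = f.corner f.normal ∧
    ∀ i, i ≠ f.normal → v i = f.corner i ∨ v i = f.corner i + 1}

/-- The vertex figure at `v` of a set `P` of squares: its vertices are the six lattice edges at
`v`, two of them being joined when some square of `P` contains both. -/
def link (P : Set Square) (v : Point) : SimpleGraph Dir where
  Adj a b := a ≠ b ∧ ∃ f ∈ P, v ∈ f.corners ∧ v + a.vec ∈ f.corners ∧ v + b.vec ∈ f.corners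
  symm := ⟨fun _ _ h => ⟨h.1.symm, h.2.imp fun _ hf => ⟨hf.1, hf.2.1, hf.2.2.2, hf.2.2.1⟩⟩⟩
  loopless := ⟨fun _ h => h.1 rfl⟩

/-- A cubic polyhedron, given by its set of faces: a set of lattice squares that forms a surface
whose vertices and edges are all the vertices and edges of the cubic lattice.  That is, every
lattice edge lies in exactly two faces, and the faces at each lattice vertex form one cycle. -/
structure IsCubicPolyhedron (P : Set Square) : Prop where
  two_faces : ∀ v d, ((link P v).neighborSet d).ncard = 2
  link_connected : ∀ v, (link P v).Connected

/-- The edge from `v` in direction `d` is a flange: the faces along it are coplanar, that is, they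
extend to opposite sides of it.  The other edges of a cubic polyhedron are its creases. -/
def IsFlange (P : Set Square) (v : Point) (d : Dir) : Prop :=
  ∃ a, (link P v).Adj d a ∧ (link P v).Adj d a.opp

/-- A monkey-saddle vertex: all six incident edges are creases. -/
def IsMonkeySaddle (P : Set Square) (v : Point) : Prop :=
  ∀ d, ¬ IsFlange P v d

/-- A screw vertex with axis `i`: there are flanges in both directions along that axis. -/
def IsScrew (P : Set Square) (v : Point) (i : Fin 3) : Prop :=
  IsFlange P v (i, 1) ∧ IsFlange P v (i, -1)

/-- The configurations at `v` and at its neighbour `v + unit i` are mirror images of each other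
in the plane halfway between these two vertices. -/
def IsMirrored (P : Set Square) (i : Fin 3) (v : Point) : Prop :=
  ∀ a b, (link P (v + unit i)).Adj a b ↔ (link P v).Adj (a.refl i) (b.refl i)

/-- In the lattice plane where the coordinate along the axis `n` equals `c`, the polyhedron `P`
has a sheet: monkey-saddles that are reflected along the other two axes. -/
def IsSheet (P : Set Square) (n : Fin 3) (c : ℤ) : Prop :=
  ∀ v : Point, v n = c → IsMonkeySaddle P v ∧ ∀ b, b ≠ n → IsMirrored P b v

/-- In the lattice plane where the coordinate along `n` equals `c`, the polyhedron `P` has a slab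
with normal `n` and axis `a`: a bi-infinite column of screws with common axis `a`, with any
sequence of handednesses, that is repeatedly reflected along the third axis (the bi-axis). -/
def IsSlab (P : Set Square) (n a : Fin 3) (c : ℤ) : Prop :=
  n ≠ a ∧ ∀ v : Point, v n = c →
    IsScrew P v a ∧ ∀ b, b ≠ n → b ≠ a → IsMirrored P b v

/-- An untwisted slab: successive screws along each column have opposite handedness, that is,
they are mirror images of each other. -/
def IsUntwistedSlab (P : Set Square) (n a : Fin 3) (c : ℤ) : Prop :=
  IsSlab P n a c ∧ ∀ v : Point, v n = c → IsMirrored P a v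

/-- A face all of whose four edges are creases. -/
def IsNormalFace (P : Set Square) (f : Square) : Prop :=
  f ∈ P ∧ ∀ v ∈ f.corners, ∀ d : Dir, v + d.vec ∈ f.corners → ¬ IsFlange P v d

/-- The lattice points on the four lines through the corners of `f` perpendicular to `f`. -/
def Square.box (f : Square) : Set Point :=
  {v | ∀ i, i ≠ f.normal → v i = f.corner i ∨ v i = f.corner i + 1}

/-- The box around `f` is a tower of `P`, with axis `f.normal`: it is obtained by repeated
reflection from the local configuration around the normal face `f`. -/
def IsTower (P : Set Square) (f : Square) : Prop :=
  IsNormalFace P f ∧ ∀ v ∈ f.box, IsMirrored P f.normal v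

/-- The squares parallel to the axis that lie within the box around `f`. -/
def Square.sides (f : Square) : Set Square :=
  {g | g.normal ≠ f.normal ∧ g.corners ⊆ f.box}

/-- `Q` is obtained from `P` by pushing some (possibly empty or infinite) set of towers of `P`
with axis `i`.  Pushing a tower removes the faces parallel to its axis within the tower and fills
in those that were missing. -/
def IsPushAlong (i : Fin 3) (P Q : Set Square) : Prop :=
  ∃ T : Set Square, (∀ f ∈ T, f.normal = i ∧ IsTower P f) ∧
    Q = symmDiff P (⋃ f ∈ T, f.sides)

/-- The polyhedron `P_0` (in any of its positions): all vertices are monkey-saddles. -/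
def IsPZero (P : Set Square) : Prop :=
  IsCubicPolyhedron P ∧ ∀ v, IsMonkeySaddle P v

/-- The letters `0`, `x`, `y` of the sequences that index the polyhedra `P_τ`. -/
inductive Letter : Type
  | zero
  | x
  | y

/-- The polyhedron `P_τ` (in any of its positions), the axes being called `x`, `y`, `z`: the layer
at height `n` along `z` is a sheet when `τ n = 0`, and otherwise it is an untwisted slab with
normal `z` and axis `τ n`. -/
def IsPTau (x y z : Fin 3) (τ : ℤ → Letter) (P : Set Square) : Prop :=
  IsCubicPolyhedron P ∧ ∀ n : ℤ,
    match τ n with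
    | Letter.zero => IsSheet P z n
    | Letter.x => IsUntwistedSlab P z x n
    | Letter.y => IsUntwistedSlab P z y n

/-- A pushed polyhedron.  For some naming `x`, `y`, `z` of the three coordinate axes, it is
obtained from `P_0` by pushing towers along `z`, then towers of the result along `y`, then towers
of the result along `x`, or it is obtained from some `P_τ` by pushing towers along `y` and then
towers of the result along `x`.  (Congruent polyhedra are covered: the axes may be permuted, and
the starting polyhedron may be in any position.) -/
def IsPushedPolyhedron (P : Set Square) : Prop :=
  ∃ x y z : Fin 3, x ≠ y ∧ y ≠ z ∧ x ≠ z ∧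
    ((∃ P₀ Q R, IsPZero P₀ ∧
        IsPushAlong z P₀ Q ∧ IsPushAlong y Q R ∧ IsPushAlong x R P) ∨
      (∃ τ Pτ R, IsPTau x y z τ Pτ ∧ IsPushAlong y Pτ R ∧ IsPushAlong x R P))

end CubicPolyhedra

/-! ### Faces as 0-1 functions, and lines of flanges -/

namespace CubicPolyhedra

/-! Flanges fill whole lattice lines (`lineX_of_r`), and two such lines never cross. Across any
other line the squares alternate. A plane normal to x cannot contain flange lines in both of its
directions, so modulo 2 its pattern is a function of y plus a function of z, at least one of them
alternating (`plane_parity`). From there on the argument is arithmetic modulo 2 that measures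
deviations from checkerboards.

Suppose flange lines occur in all three directions. Then consecutive planes never disagree on two
successive squares of a strip beside a flange line (`eq_or_eq_of_lines`). It follows that the
deviation of the y-planes in direction z and that of the z-planes in direction y agree over black
squares of a checkerboard, and both come from one set of x-towers over such squares
(`exists_towers`). The same holds for the other axes. So the polyhedron is `P_0` toggled along three
sets of towers, and `Surf.vanish_of_towers` shows that towers with different axes do not disturb
each other.

Suppose some direction, called z, has no flange lines. Absence of slabs makes the planes normal to x
agree at every level without y-flange lines, and symmetrically (`mirror_of_no_lineY`). The remaining
differences are removed by pushing x-towers and y-towers. What is left is invariant enough that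
every level is a sheet or an untwisted slab, so it is some `P_τ`. Pushing is an involution, so the
pushes can be undone to recover the given polyhedron. -/

/-- The twelve squares at a lattice vertex, as numbers `0` or `1`, form a single cycle. The letters
`p`, `q`, `r` stand for the squares normal to the three axes; the indices are `0` for the negative
and `1` for the positive side along the other two axes. -/
structure Vert (p00 p01 p10 p11 q00 q01 q10 q11 r00 r01 r10 r11 : ℤ) : Prop where
  xp : r10 + r11 + q10 + q11 = 2
  xm : r00 + r01 + q00 + q01 = 2
  yp : r01 + r11 + p10 + p11 = 2
  ym : r00 + r10 + p00 + p01 = 2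
  zp : q01 + q11 + p01 + p11 = 2
  zm : q00 + q10 + p00 + p10 = 2
  t000 : p00 + q00 + r00 ≤ 2
  t001 : p01 + q01 + r00 ≤ 2
  t010 : p10 + q00 + r01 ≤ 2
  t011 : p11 + q01 + r01 ≤ 2
  t100 : p00 + q10 + r10 ≤ 2
  t101 : p01 + q11 + r10 ≤ 2
  t110 : p10 + q10 + r11 ≤ 2
  t111 : p11 + q11 + r11 ≤ 2

/-- A cubic polyhedron in coordinates: `p`, `q`, `r` are the indicator functions of its faces
normal to the first, second and third axis, in terms of their smallest corners. -/
structure Surf (p q r : ℤ → ℤ → ℤ → ℤ) : Prop where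
  p01 : ∀ i j k, 0 ≤ p i j k ∧ p i j k ≤ 1
  q01 : ∀ i j k, 0 ≤ q i j k ∧ q i j k ≤ 1
  r01 : ∀ i j k, 0 ≤ r i j k ∧ r i j k ≤ 1
  vert : ∀ i j k, Vert (p i (j - 1) (k - 1)) (p i (j - 1) k) (p i j (k - 1)) (p i j k)
    (q (i - 1) j (k - 1)) (q (i - 1) j k) (q i j (k - 1)) (q i j k)
    (r (i - 1) (j - 1) k) (r (i - 1) j k) (r i (j - 1) k) (r i j k)

/-- The line along the first axis through `(j, k)` consists of flanges. -/
def LineX (q r : ℤ → ℤ → ℤ → ℤ) (j k : ℤ) : Prop :=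
  ∀ i, r i (j - 1) k = r i j k ∧ q i j (k - 1) = q i j k

/-- The line along the second axis through `(i, k)` consists of flanges. -/
def LineY (p r : ℤ → ℤ → ℤ → ℤ) (i k : ℤ) : Prop :=
  ∀ j, r (i - 1) j k = r i j k ∧ p i j (k - 1) = p i j k

/-- The line along the third axis through `(i, j)` consists of flanges. -/
def LineZ (p q : ℤ → ℤ → ℤ → ℤ) (i j : ℤ) : Prop :=
  ∀ k, q (i - 1) j k = q i j k ∧ p i (j - 1) k = p i j k

theorem int_forall_of_iff {Q : ℤ → Prop} (h : ∀ n, Q (n - 1) ↔ Q n) {a : ℤ} (ha : Q a) (b : ℤ) :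
    Q b := by
  induction b using Int.inductionOn' (b := a) with
  | zero => exact ha
  | succ k _ ih => exact (h (k + 1)).1 (by simpa using ih)
  | pred k _ ih => exact (h k).2 ih

/-- Unless the run of `Q` around `a - 1, a` stops on one side, it extends to all integers. The lemma
locates an end of the run with two consecutive members next to it. -/
theorem exists_boundary {Q : ℤ → Prop} {a b : ℤ} (ha : Q a) (ha' : Q (a - 1)) (hb : ¬ Q b) :
    (∃ m, Q m ∧ Q (m - 1) ∧ ¬ Q (m + 1)) ∨ (∃ m, Q m ∧ Q (m - 1) ∧ ¬ Q (m - 2)) := by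
  by_contra hc
  push Not at hc
  obtain ⟨h1, h2⟩ := hc
  refine hb (int_forall_of_iff (Q := fun n => Q n ∧ Q (n - 1)) (fun n => ?_) ⟨ha, ha'⟩ b).1
  constructor
  · rintro ⟨h3, h4⟩
    exact ⟨by simpa using h1 (n - 1) h3 h4, h3⟩
  · rintro ⟨h3, h4⟩
    exact ⟨h4, by simpa [sub_sub] using h2 n h3 h4⟩

theorem parity_of_alternating {f : ℤ → ℤ} (h : ∀ n, f (n - 1) + f n = 1) (m n : ℤ) :
    (f m + f n + m + n) % 2 = 0 := by
  refine int_forall_of_iff (Q := fun m => (f m + f n + m + n) % 2 = 0) (fun m => ?_)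
    (a := n) (by omega) m
  have := h m
  omega

variable {p q r : ℤ → ℤ → ℤ → ℤ}

namespace Surf

theorem swapXY (h : Surf p q r) :
    Surf (fun i j k => q j i k) (fun i j k => p j i k) (fun i j k => r j i k) where
  p01 i j k := h.q01 _ _ _
  q01 i j k := h.p01 _ _ _
  r01 i j k := h.r01 _ _ _
  vert i j k := by
    obtain ⟨xp, xm, yp, ym, zp, zm, t0, t1, t2, t3, t4, t5, t6, t7⟩ := h.vert j i k
    constructor <;> omega

theorem swapYZ (h : Surf p q r) :
    Surf (fun i j k => p i k j) (fun i j k => r i k j) (fun i j k => q i k j) where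
  p01 i j k := h.p01 _ _ _
  q01 i j k := h.r01 _ _ _
  r01 i j k := h.q01 _ _ _
  vert i j k := by
    obtain ⟨xp, xm, yp, ym, zp, zm, t0, t1, t2, t3, t4, t5, t6, t7⟩ := h.vert i k j
    constructor <;> omega

/-- If the cycle at a vertex passes through y, x, -y, then the other three directions -x, z, -z form
a path. Since z and -z are not joined, -x is its middle. So the opposite edge is a flange too, in
the perpendicular plane, and flanges propagate along the line. -/
theorem lineX_of_r (h : Surf p q r) {i j k : ℤ} (e : r i (j - 1) k = r i j k) :
    LineX q r j k := by
  have key := int_forall_of_iff (Q := fun i => r i (j - 1) k = r i j k) (fun i => ?_) e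
  · intro i
    have h1 := key i
    obtain ⟨xp, xm, yp, ym, zp, zm, t0, t1, t2, t3, t4, t5, t6, t7⟩ := h.vert i j k
    have := h.r01 i j k
    have := h.q01 i j k
    have := h.q01 i j (k - 1)
    omega
  · obtain ⟨xp, xm, yp, ym, zp, zm, t0, t1, t2, t3, t4, t5, t6, t7⟩ := h.vert i j k
    have := h.p01 i j k
    have := h.p01 i (j - 1) k
    have := h.p01 i j (k - 1)
    have := h.p01 i (j - 1) (k - 1)
    have := h.r01 i j k
    have := h.r01 (i - 1) j k
    have := h.r01 i (j - 1) k
    have := h.r01 (i - 1) (j - 1) k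
    have := h.q01 i j k
    have := h.q01 i j (k - 1)
    have := h.q01 (i - 1) j k
    have := h.q01 (i - 1) j (k - 1)
    constructor <;> intro e <;> by_contra e' <;> omega

theorem lineX_of_q (h : Surf p q r) {i j k : ℤ} (e : q i j (k - 1) = q i j k) :
    LineX q r j k :=
  fun i => (h.swapYZ.lineX_of_r e i).symm

theorem lineY_of_p (h : Surf p q r) {i j k : ℤ} (e : p i j (k - 1) = p i j k) :
    LineY p r i k :=
  h.swapXY.lineX_of_q e

theorem add_of_not_lineX (h : Surf p q r) {j k : ℤ} (hn : ¬ LineX q r j k) (i : ℤ) :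
    r i (j - 1) k + r i j k = 1 ∧ q i j (k - 1) + q i j k = 1 := by
  have h1 : r i (j - 1) k ≠ r i j k := fun e => hn (h.lineX_of_r e)
  have h2 : q i j (k - 1) ≠ q i j k := fun e => hn (h.lineX_of_q e)
  have := h.r01 i j k
  have := h.r01 i (j - 1) k
  have := h.q01 i j k
  have := h.q01 i j (k - 1)
  omega

theorem add_of_not_lineY (h : Surf p q r) {i k : ℤ} (hn : ¬ LineY p r i k) (j : ℤ) :
    r (i - 1) j k + r i j k = 1 ∧ p i j (k - 1) + p i j k = 1 :=
  h.swapXY.add_of_not_lineX hn j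

theorem add_of_not_lineZ (h : Surf p q r) {i j : ℤ} (hn : ¬ LineZ p q i j) (k : ℤ) :
    q (i - 1) j k + q i j k = 1 ∧ p i (j - 1) k + p i j k = 1 :=
  h.swapYZ.add_of_not_lineY hn k

theorem r_add_q_of_lineX (h : Surf p q r) {j k : ℤ} (hX : LineX q r j k) (i : ℤ) :
    r i j k + q i j k = 1 := by
  have := (h.vert i j k).xp
  have := hX i
  omega

/-- With flanges at x and -x the cycle is y, x, -y, ±z, -x, ∓z, in which no other direction has
opposite neighbours. Hence flange lines never cross. -/
theorem not_lineY_of_lineX (h : Surf p q r) {j k : ℤ} (hX : LineX q r j k) (i : ℤ) :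
    ¬ LineY p r i k := by
  intro hY
  obtain ⟨xp, xm, yp, ym, zp, zm, t0, t1, t2, t3, t4, t5, t6, t7⟩ := h.vert i j k
  have := hX i
  have := hX (i - 1)
  have := hY j
  have := hY (j - 1)
  have := h.r01 i j k
  have := h.p01 i j k
  omega

theorem not_lineZ_of_lineX (h : Surf p q r) {j k : ℤ} (hX : LineX q r j k) (i : ℤ) :
    ¬ LineZ p q i j :=
  h.swapYZ.not_lineY_of_lineX (fun i => (hX i).symm) i

theorem not_lineZ_of_lineY (h : Surf p q r) {i k : ℤ} (hY : LineY p r i k) (j : ℤ) :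
    ¬ LineZ p q i j :=
  fun hZ => h.swapXY.not_lineZ_of_lineX hY j fun k => (hZ k).symm

/-- At a monkey-saddle, crossing a coordinate plane flips exactly two of the three squares of an
octant. So all octants have the same parity, and odd parity would produce an octant with all three
squares. -/
theorem even_of_not_line (h : Surf p q r) {i j k : ℤ} (hX : ¬ LineX q r j k)
    (hY : ¬ LineY p r i k) (hZ : ¬ LineZ p q i j) : (p i j k + q i j k + r i j k) % 2 = 0 := by
  obtain ⟨xp, xm, yp, ym, zp, zm, t0, t1, t2, t3, t4, t5, t6, t7⟩ := h.vert i j k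
  have := h.add_of_not_lineX hX i
  have := h.add_of_not_lineX hX (i - 1)
  have := h.add_of_not_lineY hY j
  have := h.add_of_not_lineY hY (j - 1)
  have := h.add_of_not_lineZ hZ k
  have := h.add_of_not_lineZ hZ (k - 1)
  have := h.p01 i j k
  have := h.q01 i j k
  have := h.r01 i j k
  omega

/-- Each lattice plane is the sum of a function of one and a function of the other coordinate. -/
theorem plane_parity (h : Surf p q r) (i j j' k k' : ℤ) :
    (p i j k + p i j' k + p i j k' + p i j' k') % 2 = 0 := by
  by_cases hZ : ∃ j, LineZ p q i j
  · obtain ⟨m, hm⟩ := hZ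
    -- The flange line in the third direction crosses every line of this plane in the second
    -- direction, so none of those consists of flanges.
    have h1 : ∀ j k, p i j (k - 1) + p i j k = 1 := fun j k =>
      (h.add_of_not_lineY (fun hY => h.not_lineZ_of_lineY hY m hm) j).2
    have := parity_of_alternating (f := fun k => p i j k) (h1 j) k k'
    have := parity_of_alternating (f := fun k => p i j' k) (h1 j') k k'
    omega
  · push Not at hZ
    have h1 : ∀ k j, p i (j - 1) k + p i j k = 1 := fun k j => (h.add_of_not_lineZ (hZ j) k).2
    have := parity_of_alternating (f := fun j => p i j k) (h1 k) j j'
    have := parity_of_alternating (f := fun j => p i j k') (h1 k') j j'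
    omega

/-- Where two consecutive planes are complementary around a vertex, there is a line of flanges. -/
theorem lineX_of_complementary (h : Surf p q r) {i j k : ℤ}
    (h1 : p i (j - 1) (k - 1) ≠ p (i + 1) (j - 1) (k - 1))
    (h2 : p i (j - 1) k ≠ p (i + 1) (j - 1) k) (h3 : p i j (k - 1) ≠ p (i + 1) j (k - 1))
    (h4 : p i j k ≠ p (i + 1) j k) : LineX q r j k := by
  by_contra hX
  have ha := h.vert i j k
  have hb := h.vert (i + 1) j k
  simp only [add_sub_cancel_right] at hb
  obtain ⟨xp, xm, yp, ym, zp, zm, t0, t1, t2, t3, t4, t5, t6, t7⟩ := ha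
  obtain ⟨-, xm', yp', ym', zp', zm', t0', t1', t2', t3', t4', t5', t6', t7'⟩ := hb
  have := h.add_of_not_lineX hX i
  have := h.p01 i j k
  have := h.p01 i (j - 1) k
  have := h.p01 i j (k - 1)
  have := h.p01 i (j - 1) (k - 1)
  have := h.p01 (i + 1) j k
  have := h.p01 (i + 1) (j - 1) k
  have := h.p01 (i + 1) j (k - 1)
  have := h.p01 (i + 1) (j - 1) (k - 1)
  have := h.r01 i j k
  have := h.q01 i j k
  have := h.r01 i (j - 1) k
  have := h.q01 i j (k - 1)
  clear xm yp ym zp zm yp' ym' zp' zm' xm' t0 t1 t2 t3 t4' t5' t6' t7'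
  omega

end Surf

/-! ### Where consecutive planes disagree -/

namespace Surf

theorem reflY (h : Surf p q r) :
    Surf (fun i j k => p i (-j - 1) k) (fun i j k => q i (-j) k) (fun i j k => r i (-j - 1) k) where
  p01 i j k := h.p01 _ _ _
  q01 i j k := h.q01 _ _ _
  r01 i j k := h.r01 _ _ _
  vert i j k := by
    have e : -(j - 1) - 1 = -j := by ring
    rw [e]
    obtain ⟨xp, xm, yp, ym, zp, zm, t0, t1, t2, t3, t4, t5, t6, t7⟩ := h.vert i (-j) k
    constructor <;> omega

theorem reflZ (h : Surf p q r) :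
    Surf (fun i j k => p i j (-k - 1)) (fun i j k => q i j (-k - 1)) (fun i j k => r i j (-k)) :=
  h.swapYZ.reflY.swapYZ

theorem lineX_reflY {j k : ℤ} (hX : LineX q r j k) :
    LineX (fun i j k => q i (-j) k) (fun i j k => r i (-j - 1) k) (-j) k := by
  intro i
  have e : -(-j - 1) - 1 = j := by ring
  simp only [e, neg_neg]
  exact ⟨(hX i).1.symm, (hX i).2⟩

theorem lineX_reflZ {j k : ℤ} (hX : LineX q r j k) :
    LineX (fun i j k => q i j (-k - 1)) (fun i j k => r i j (-k)) j (-k) :=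
  fun i => (lineX_reflY (q := fun i j k => r i k j) (r := fun i j k => q i k j)
    (fun i => (hX i).symm) i).symm

/-- By `plane_parity` in both planes, their disagreement is modulo 2 a function of `j` plus a
function of `k`. So two rows of it are equal or complementary. -/
theorem agree_iff_agree (h : Surf p q r) {i j j' k : ℤ}
    (e : p i j k = p (i + 1) j k ↔ p i j' k = p (i + 1) j' k) (k' : ℤ) :
    p i j k' = p (i + 1) j k' ↔ p i j' k' = p (i + 1) j' k' := by
  have e1 := h.plane_parity i j j' k k'
  have e2 := h.plane_parity (i + 1) j j' k k'
  have := h.p01 i j k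
  have := h.p01 i j' k
  have := h.p01 i j k'
  have := h.p01 i j' k'
  have := h.p01 (i + 1) j k
  have := h.p01 (i + 1) j' k
  have := h.p01 (i + 1) j k'
  have := h.p01 (i + 1) j' k'
  omega

theorem agree_iff_agree' (h : Surf p q r) {i j k k' : ℤ}
    (e : p i j k = p (i + 1) j k ↔ p i j k' = p (i + 1) j k') (j' : ℤ) :
    p i j' k = p (i + 1) j' k ↔ p i j' k' = p (i + 1) j' k' :=
  h.swapYZ.agree_iff_agree e j'

/-- The flange line forbids z-flange lines through its vertices, so both planes flip from `j - 1` to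
`j`. -/
theorem lineX_agree (h : Surf p q r) {j k : ℤ} (hX : LineX q r j k) (i k' : ℤ) :
    p i j k' = p (i + 1) j k' ↔ p i (j - 1) k' = p (i + 1) (j - 1) k' := by
  refine h.agree_iff_agree (k := k) ?_ k'
  have := (h.add_of_not_lineZ (h.not_lineZ_of_lineX hX i) k).2
  have := (h.add_of_not_lineZ (h.not_lineZ_of_lineX hX (i + 1)) k).2
  omega

theorem lineX_agree' (h : Surf p q r) {j k : ℤ} (hX : LineX q r j k) (i j' : ℤ) :
    p i j' k = p (i + 1) j' k ↔ p i j' (k - 1) = p (i + 1) j' (k - 1) :=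
  h.swapYZ.lineX_agree (fun i => (hX i).symm) i j'

-- A region of disagreement cannot have a corner at a flange line. Otherwise the planes would
-- disagree at `(j + 1, k + 1)` as well, and by `lineX_agree` none of the three x-lines at the other
-- corners of the square could consist of flanges. The squares between the two planes are then
-- determined by `r i j k`, and every choice puts three squares into one octant.
set_option maxHeartbeats 1000000 in
theorem corner (h : Surf p q r) {i j k : ℤ} (hX : LineX q r j k)
    (h00 : p i j k ≠ p (i + 1) j k) (h10 : p i (j + 1) k = p (i + 1) (j + 1) k) :
    p i j (k + 1) ≠ p (i + 1) j (k + 1) := by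
  intro h01
  have hY := fun i => h.add_of_not_lineY (h.not_lineY_of_lineX hX i)
  have hZ := fun i => h.add_of_not_lineZ (h.not_lineZ_of_lineX hX i)
  have y1 := hY i j
  have y2 := hY (i + 1) j
  have z1 := hZ i k
  have z2 := hZ (i + 1) k
  have b00 := h.p01 i j k
  have b10 := h.p01 i (j + 1) k
  have b01 := h.p01 i j (k + 1)
  have b11 := h.p01 i (j + 1) (k + 1)
  have bm0 := h.p01 i (j - 1) (k + 1)
  have b0m := h.p01 i (j + 1) (k - 1)
  have c00 := h.p01 (i + 1) j k
  have c10 := h.p01 (i + 1) (j + 1) k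
  have c01 := h.p01 (i + 1) j (k + 1)
  have c11 := h.p01 (i + 1) (j + 1) (k + 1)
  have cm0 := h.p01 (i + 1) (j - 1) (k + 1)
  have c0m := h.p01 (i + 1) (j + 1) (k - 1)
  have d00 := h.r01 i j k
  have d01 := h.q01 i j k
  have a0m := h.lineX_agree' hX i (j + 1)
  have am0 := h.lineX_agree hX i (k + 1)
  have n10 : ¬ LineX q r (j + 1) k := fun hX => by
    have := h.lineX_agree hX i k
    simp only [add_sub_cancel_right] at this
    tauto
  have n01 : ¬ LineX q r j (k + 1) := fun hX => by
    have := h.lineX_agree' hX i j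
    simp only [add_sub_cancel_right] at this
    tauto
  have h11 : ¬ p i (j + 1) (k + 1) = p (i + 1) (j + 1) (k + 1) := fun h11 =>
    h00 ((h.agree_iff_agree (iff_of_true h01 h11) k).2 h10)
  have n11 : ¬ LineX q r (j + 1) (k + 1) := fun hX => by
    have := h.lineX_agree hX i (k + 1)
    simp only [add_sub_cancel_right] at this
    tauto
  have := hX i
  have := h.r_add_q_of_lineX hX i
  have := h.add_of_not_lineX n10 i
  have := h.add_of_not_lineX n01 i
  have := h.add_of_not_lineX n11 i
  have v11 := h.vert i (j + 1) (k + 1)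
  have v11' := h.vert (i + 1) (j + 1) (k + 1)
  have v10 := h.vert i (j + 1) k
  have v10' := h.vert (i + 1) (j + 1) k
  have v01 := h.vert i j (k + 1)
  have v01' := h.vert (i + 1) j (k + 1)
  simp only [add_sub_cancel_right] at *
  obtain ⟨-, -, -, -, -, -, -, -, -, -, s4, s5, s6, s7⟩ := v11
  obtain ⟨-, -, -, -, -, -, s0, s1, s2, s3, -, -, -, -⟩ := v11'
  obtain ⟨-, -, -, -, -, -, -, -, -, -, t4, t5, t6, t7⟩ := v10
  obtain ⟨-, -, -, -, -, -, t0, t1, t2, t3, -, -, -, -⟩ := v10'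
  obtain ⟨-, -, -, -, -, -, -, -, -, -, u4, u5, u6, u7⟩ := v01
  obtain ⟨-, -, -, -, -, -, u0, u1, u2, u3, -, -, -, -⟩ := v01'
  have hb : ∀ a : ℤ, 0 ≤ a ∧ a ≤ 1 → a = 0 ∨ a = 1 := fun a h => by omega
  rcases hb _ b00 with g1 | g1 <;> rcases hb _ b10 with g2 | g2 <;>
    rcases hb _ b01 with g3 | g3 <;> rcases hb _ d00 with g4 | g4 <;> omega

theorem corner_neg (h : Surf p q r) {i j k : ℤ} (hX : LineX q r j k)
    (h00 : p i (j - 1) k ≠ p (i + 1) (j - 1) k) (h10 : p i (j - 2) k = p (i + 1) (j - 2) k) :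
    p i (j - 1) (k + 1) ≠ p (i + 1) (j - 1) (k + 1) := by
  have e : -(-j + 1) - 1 = j - 2 := by ring
  have := h.reflY.corner (lineX_reflY hX) (i := i) (by simpa using h00)
    (by simpa only [e] using h10)
  simpa using this

theorem corner' (h : Surf p q r) {i j k : ℤ} (hX : LineX q r j k)
    (h00 : p i j (k - 1) ≠ p (i + 1) j (k - 1))
    (h10 : p i (j + 1) (k - 1) = p (i + 1) (j + 1) (k - 1)) :
    p i j (k - 2) ≠ p (i + 1) j (k - 2) := by
  have e : -(-k + 1) - 1 = k - 2 := by ring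
  have := h.reflZ.corner (lineX_reflZ hX) (i := i) (by simpa using h00)
    (by simpa using h10)
  simpa only [e] using this

theorem corner_neg' (h : Surf p q r) {i j k : ℤ} (hX : LineX q r j k)
    (h00 : p i (j - 1) (k - 1) ≠ p (i + 1) (j - 1) (k - 1))
    (h10 : p i (j - 2) (k - 1) = p (i + 1) (j - 2) (k - 1)) :
    p i (j - 1) (k - 2) ≠ p (i + 1) (j - 1) (k - 2) := by
  have e : -(-k + 1) - 1 = k - 2 := by ring
  have := h.reflZ.corner_neg (lineX_reflZ hX) (i := i) (by simpa using h00)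
    (by simpa using h10)
  simpa only [e] using this

/-- If there are lines of flanges in all three directions, then, along a lattice line through a
line of flanges, consecutive planes do not differ on two successive squares. -/
theorem eq_or_eq_of_lines (h : Surf p q r) {j₀ k₀ i₁ k₁ i₂ j₂ : ℤ} (hX : LineX q r j₀ k₀)
    (hY : LineY p r i₁ k₁) (hZ : LineZ p q i₂ j₂) (i k : ℤ) :
    p i j₀ (k - 1) = p (i + 1) j₀ (k - 1) ∨ p i j₀ k = p (i + 1) j₀ k := by
  by_contra hc
  push Not at hc
  obtain ⟨hk', hk⟩ := hc
  have hj := h.lineX_agree hX i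
  -- Otherwise the planes are complementary around `(j₀, k₁)`, and the resulting x-flange line
  -- crosses the given y-flange line. The next claim uses the z-flange line in the same way.
  obtain ⟨b, hb⟩ : ∃ b, p i j₀ b = p (i + 1) j₀ b := by
    by_contra hc
    push Not at hc
    refine h.not_lineY_of_lineX (h.lineX_of_complementary (i := i) (j := j₀) (k := k₁) ?_ ?_ ?_ ?_)
      i₁ hY
    · exact fun e => hc _ ((hj _).2 e)
    · exact fun e => hc _ ((hj _).2 e)
    · exact hc _
    · exact hc _
  let Q : ℤ → Prop := fun j => p i j k ≠ p (i + 1) j k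
  obtain ⟨a, ha⟩ : ∃ a, ¬ Q a := by
    by_contra hc
    push Not at hc
    have e := fun j => h.agree_iff_agree (iff_of_false (hc j) hk) (k - 1)
    refine h.not_lineZ_of_lineX (h.lineX_of_complementary (i := i) (j := j₂) (k := k) ?_ ?_ ?_ ?_)
      i₂ hZ
    · exact fun e' => hk' ((e _).1 e')
    · exact hc _
    · exact fun e' => hk' ((e _).1 e')
    · exact hc _
  have key : ∃ m, Q m ∧ Q (m - 1) ∧ (¬ Q (m + 1) ∨ ¬ Q (m - 2)) := by
    rcases exists_boundary (Q := Q) hk (fun e => hk ((hj k).2 e)) ha with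
      ⟨m, h1, h2, h3⟩ | ⟨m, h1, h2, h3⟩
    · exact ⟨m, h1, h2, Or.inl h3⟩
    · exact ⟨m, h1, h2, Or.inr h3⟩
  obtain ⟨m, hm, hm', ha⟩ := key
  have tr := fun k' => h.agree_iff_agree (iff_of_false hm hk) k'
  have tr' := fun k' => h.agree_iff_agree (iff_of_false hm' hk) k'
  rcases exists_boundary (Q := fun k => p i j₀ k ≠ p (i + 1) j₀ k) (b := b) hk hk'
    (fun e => e hb) with ⟨n, h1, h2, h3⟩ | ⟨n, h1, h2, h3⟩
  all_goals
    have n1 := fun e => h1 ((tr n).1 e)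
    have n2 := fun e => h2 ((tr (n - 1)).1 e)
    have n1' := fun e => h1 ((tr' n).1 e)
    have n2' := fun e => h2 ((tr' (n - 1)).1 e)
    -- All four squares around `(m, n)` disagree, so an x-flange line runs there. Both runs end next
    -- to it, which is the corner excluded above, up to reflections.
    have line := h.lineX_of_complementary n2' n1' n2 n1
    push Not at h3
    replace ha := ha.imp not_not.1 not_not.1
  · have row := h.agree_iff_agree' (iff_of_false hm n1)
    rcases ha with ha | ha
    · exact h.corner line n1 ((row _).1 ha) ((tr _).2 h3)
    · exact h.corner_neg line n1' ((row _).1 ha) ((tr' _).2 h3)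
  · have row := h.agree_iff_agree' (iff_of_false hm n2)
    rcases ha with ha | ha
    · exact h.corner' line n2 ((row _).1 ha) ((tr _).2 h3)
    · exact h.corner_neg' line n2' ((row _).1 ha) ((tr' _).2 h3)

end Surf

/-! ### Flange lines in all three directions: deviations from checkerboards -/

namespace Surf

variable {j₀ k₀ i₁ k₁ i₂ j₂ : ℤ}

/-- Consecutive planes agree on both sides of a flange line or on neither, and `eq_or_eq_of_lines`
excludes the latter. -/
theorem mirror_of_lineX (h : Surf p q r) (hX : LineX q r j₀ k₀)
    (hY : LineY p r i₁ k₁) (hZ : LineZ p q i₂ j₂) (i i' : ℤ) : p i j₀ k₀ = p i' j₀ k₀ := by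
  refine int_forall_of_iff (Q := fun i => p i j₀ k₀ = p i' j₀ k₀) (fun i => ?_) rfl i
  have h1 := h.eq_or_eq_of_lines hX hY hZ (i - 1) k₀
  have h2 := h.lineX_agree' hX (i - 1) j₀
  simp only [sub_add_cancel] at h1 h2
  have : p (i - 1) j₀ k₀ = p i j₀ k₀ := by tauto
  simp only [this]

theorem mirror_of_lineY (h : Surf p q r) (hX : LineX q r j₀ k₀)
    (hY : LineY p r i₁ k₁) (hZ : LineZ p q i₂ j₂) (j j' : ℤ) : q i₁ j k₁ = q i₁ j' k₁ :=
  h.swapXY.mirror_of_lineX hY hX (fun k => (hZ k).symm) j j'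

theorem mirror_of_lineZ (h : Surf p q r) (hX : LineX q r j₀ k₀)
    (hY : LineY p r i₁ k₁) (hZ : LineZ p q i₂ j₂) (k k' : ℤ) : r i₂ j₂ k = r i₂ j₂ k' :=
  h.swapYZ.mirror_of_lineY (fun i => (hX i).symm) hZ hY k k'

theorem parity_x_j (h : Surf p q r) {i : ℤ} (hn : ∀ j, ¬ LineZ p q i j) (j j' k : ℤ) :
    (p i j k + p i j' k + j + j') % 2 = 0 :=
  parity_of_alternating (f := fun j => p i j k) (fun j => (h.add_of_not_lineZ (hn j) k).2) j j'

theorem parity_x_k (h : Surf p q r) {i : ℤ} (hn : ∀ k, ¬ LineY p r i k) (j k k' : ℤ) :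
    (p i j k + p i j k' + k + k') % 2 = 0 :=
  h.swapYZ.parity_x_j hn k k' j

theorem parity_y_i (h : Surf p q r) {j : ℤ} (hn : ∀ i, ¬ LineZ p q i j) (i i' k : ℤ) :
    (q i j k + q i' j k + i + i') % 2 = 0 :=
  h.swapXY.parity_x_j (fun i hZ => hn i fun k => (hZ k).symm) i i' k

theorem parity_y_k (h : Surf p q r) {j : ℤ} (hn : ∀ k, ¬ LineX q r j k) (i k k' : ℤ) :
    (q i j k + q i j k' + k + k') % 2 = 0 :=
  h.swapXY.parity_x_k hn i k k'

theorem parity_z_i (h : Surf p q r) {k : ℤ} (hn : ∀ i, ¬ LineY p r i k) (i i' j : ℤ) :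
    (r i j k + r i' j k + i + i') % 2 = 0 :=
  h.swapYZ.parity_y_i (fun i hY => hn i hY) i i' j

theorem parity_z_j (h : Surf p q r) {k : ℤ} (hn : ∀ j, ¬ LineX q r j k) (i j j' : ℤ) :
    (r i j k + r i j' k + j + j') % 2 = 0 :=
  h.swapYZ.parity_y_k (fun j hX => hn j fun i => (hX i).symm) i j j'

/-- An x-flange line at level `k` excludes y-flange lines there, so every plane flips from `k - 1`
to `k`, and consecutive planes, unable to disagree on both squares, agree on both. The comparison
plane is `i₂`: it contains a z-flange line, hence no y-flange line, and so alternates in `k`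
throughout. -/
theorem vanish_k (h : Surf p q r) (hX : LineX q r j₀ k₀) (hY : LineY p r i₁ k₁)
    (hZ : LineZ p q i₂ j₂) {j k : ℤ} (hX' : LineX q r j k) (i : ℤ) :
    (p i j₀ k + p i j₀ k₀ + k + k₀) % 2 = 0 ∧
      (p i j₀ (k - 1) + p i j₀ k₀ + (k - 1) + k₀) % 2 = 0 := by
  have hnY := fun i => (h.add_of_not_lineY (h.not_lineY_of_lineX hX' i) j₀).2
  have key : p i j₀ k = p i₂ j₀ k := by
    refine int_forall_of_iff (Q := fun i => p i j₀ k = p i₂ j₀ k) (fun i => ?_) rfl i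
    have h1 := h.eq_or_eq_of_lines hX hY hZ (i - 1) k
    have h2 := hnY i
    have h3 := hnY (i - 1)
    simp only [sub_add_cancel] at h1
    omega
  have h1 := hnY i
  have h2 := h.mirror_of_lineX hX hY hZ i i₂
  have h3 := h.parity_x_k (i := i₂) (fun k hY' => h.not_lineZ_of_lineY hY' _ hZ) j₀ k k₀
  omega

theorem vanish_j (h : Surf p q r) (hX : LineX q r j₀ k₀) (hY : LineY p r i₁ k₁)
    (hZ : LineZ p q i₂ j₂) {j k : ℤ} (hX' : LineX q r j k) (i : ℤ) :
    (p i j k₀ + p i j₀ k₀ + j + j₀) % 2 = 0 ∧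
      (p i (j - 1) k₀ + p i j₀ k₀ + (j - 1) + j₀) % 2 = 0 :=
  h.swapYZ.vanish_k (fun i => (hX i).symm) hZ hY (fun i => (hX' i).symm) i

/-- From `k - 1` to `k` the function `q` is constant at a flange line and flips at any other, so
exactly one of the lines at `j` and `j + 1` consists of flanges. The vertex on the other is a
monkey-saddle, whose parity gives the value of `p`. -/
theorem white_of_ne_of_eq (h : Surf p q r) {i j k : ℤ} (hne : q i j k ≠ q i (j + 1) k)
    (he : q i j (k - 1) = q i (j + 1) (k - 1)) (hZ : ¬ LineZ p q i j)
    (hZ' : ¬ LineZ p q i (j + 1)) : p i j k = 0 ∧ ∃ m, LineX q r m k := by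
  have bq := h.q01 i j k
  have bq' := h.q01 i (j + 1) k
  have z := (h.add_of_not_lineZ hZ' k).2
  by_cases l1 : LineX q r j k <;> by_cases l2 : LineX q r (j + 1) k
  · have := (l1 i).2
    have := (l2 i).2
    omega
  · have e := h.even_of_not_line l2 (h.not_lineY_of_lineX l1 i) hZ'
    have := h.add_of_not_lineX l2 i
    have := h.r_add_q_of_lineX l1 i
    have := h.p01 i (j + 1) k
    simp only [add_sub_cancel_right] at *
    refine ⟨?_, _, l1⟩
    omega
  · have e := h.even_of_not_line l1 (h.not_lineY_of_lineX l2 i) hZ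
    have := l2 i
    have := h.r_add_q_of_lineX l2 i
    have := h.p01 i j k
    simp only [add_sub_cancel_right] at *
    refine ⟨?_, _, l2⟩
    omega
  · have := h.add_of_not_lineX l1 i
    have := h.add_of_not_lineX l2 i
    omega

/-- The parity in the conclusion colours a checkerboard: odd squares are black, the faces of the
initial `P_0` normal to x, and even ones are white. -/
theorem white_of_ne (h : Surf p q r) (hX : LineX q r j₀ k₀) (hY : LineY p r i₁ k₁)
    (hZ : LineZ p q i₂ j₂) {j k : ℤ} (hne : q i₁ j k ≠ q i₁ (j + 1) k) :
    (p 0 j₀ k₀ + j₀ + k₀ + j + k) % 2 = 0 := by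
  have he := (h.swapXY.eq_or_eq_of_lines hY hX (fun k => (hZ k).symm) j k).resolve_right hne
  have hnZ : ∀ j, ¬ LineZ p q i₁ j := fun j => h.not_lineZ_of_lineY hY j
  obtain ⟨hp, m, hm⟩ := h.white_of_ne_of_eq hne he (hnZ j) (hnZ (j + 1))
  have h1 := (h.vanish_k hX hY hZ hm i₁).1
  have h2 := h.parity_x_j hnZ j j₀ k
  have h3 := h.mirror_of_lineX hX hY hZ i₁ 0
  omega

theorem white_of_ne' (h : Surf p q r) (hX : LineX q r j₀ k₀) (hY : LineY p r i₁ k₁)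
    (hZ : LineZ p q i₂ j₂) {j k : ℤ} (hne : r i₂ j k ≠ r i₂ j (k + 1)) :
    (p 0 j₀ k₀ + j₀ + k₀ + j + k) % 2 = 0 := by
  have := h.swapYZ.white_of_ne (fun i => (hX i).symm) hZ hY hne
  omega

/-- At the vertex `(i₁, j₂, k₀)` each of the three lines crosses one of the given flange lines, so
it is a monkey-saddle. Its parity is the condition under which three checkerboards form a `P_0`. -/
theorem sum_even (h : Surf p q r) (hX : LineX q r j₀ k₀) (hY : LineY p r i₁ k₁)
    (hZ : LineZ p q i₂ j₂) :
    (p 0 j₀ k₀ + j₀ + k₀ + (q i₁ 0 k₁ + i₁ + k₁) + (r i₂ j₂ 0 + i₂ + j₂)) % 2 = 0 := by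
  have nX : ∀ k, ¬ LineX q r j₂ k := fun k hX => h.not_lineZ_of_lineX hX i₂ hZ
  have nY : ∀ i, ¬ LineY p r i k₀ := h.not_lineY_of_lineX hX
  have nZ : ∀ j, ¬ LineZ p q i₁ j := h.not_lineZ_of_lineY hY
  have h0 := h.even_of_not_line (nX k₀) (nY i₁) (nZ j₂)
  have h1 := h.parity_x_j nZ j₂ j₀ k₀
  have h2 := h.parity_y_k nX i₁ k₀ k₁
  have h3 := h.parity_z_i nY i₁ i₂ j₂
  have h4 := h.mirror_of_lineX hX hY hZ i₁ 0
  have h5 := h.mirror_of_lineY hX hY hZ j₂ 0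
  have h6 := h.mirror_of_lineZ hX hY hZ k₀ 0
  omega

/-- The two brackets are the deviations of the y-plane in direction z and of the z-plane in
direction y. With an x-flange line at level `k`, `p` is 1 over a black square, so exactly one of
`q`, `r` is 1 there, which links the deviations. With a y-flange line both vanish. -/
theorem black_even_of_line (h : Surf p q r) (hX : LineX q r j₀ k₀) (hY : LineY p r i₁ k₁)
    (hZ : LineZ p q i₂ j₂) {j k : ℤ} (hb : (p 0 j₀ k₀ + j₀ + k₀ + j + k) % 2 = 1)
    (hk : (∃ m, LineX q r m k) ∨ (∃ m, LineY p r m k)) :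
    (q i₁ j k + q i₁ 0 k₁ + k + k₁ + (r i₂ j k + r i₂ j₂ 0 + j + j₂)) % 2 = 0 := by
  rcases hk with ⟨m, hm⟩ | ⟨m, hm⟩
  · have nY : ∀ i, ¬ LineY p r i k := h.not_lineY_of_lineX hm
    have nZ : ∀ j, ¬ LineZ p q i₁ j := h.not_lineZ_of_lineY hY
    have h1 := (h.vanish_k hX hY hZ hm i₁).1
    have h2 := h.parity_x_j nZ j j₀ k
    have h3 := h.mirror_of_lineX hX hY hZ i₁ 0
    have h4 := h.parity_z_i nY i₁ i₂ j
    have h5 := h.sum_even hX hY hZ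
    have h6 : (q i₁ j k + r i₁ j k) % 2 = 1 := by
      by_cases l : LineX q r j k
      · have := h.r_add_q_of_lineX l i₁
        omega
      · have := h.even_of_not_line l (nY i₁) (nZ j)
        omega
    omega
  · have h1 := (h.swapXY.vanish_k hY hX (fun k => (hZ k).symm) hm j).1
    have h2 := h.parity_z_j (fun j hX => h.not_lineY_of_lineX hX m hm) i₂ j j₂
    have h3 := h.mirror_of_lineY hX hY hZ j 0
    have h4 := h.mirror_of_lineZ hX hY hZ k 0
    omega

theorem black_even (h : Surf p q r) (hX : LineX q r j₀ k₀) (hY : LineY p r i₁ k₁)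
    (hZ : LineZ p q i₂ j₂) {j k : ℤ} (hb : (p 0 j₀ k₀ + j₀ + k₀ + j + k) % 2 = 1) :
    (q i₁ j k + q i₁ 0 k₁ + k + k₁ + (r i₂ j k + r i₂ j₂ 0 + j + j₂)) % 2 = 0 := by
  by_cases hk : (∃ m, LineX q r m k) ∨ (∃ m, LineY p r m k)
  · exact h.black_even_of_line hX hY hZ hb hk
  by_cases hj : (∃ m, LineX q r j m) ∨ (∃ m, LineZ p q m j)
  · have := h.swapYZ.black_even_of_line (fun i => (hX i).symm) hZ hY (j := k) (k := j)
      (by omega) (hj.imp (fun ⟨m, hm⟩ => ⟨m, fun i => (hm i).symm⟩) id)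
    omega
  push Not at hk hj
  have h1 := h.parity_y_k hj.1 i₁ k k₁
  have h2 := h.parity_z_j hk.1 i₂ j j₂
  have h3 := h.mirror_of_lineY hX hY hZ j 0
  have h4 := h.mirror_of_lineZ hX hY hZ k 0
  omega

/-- If there are lines of flanges in all three directions, then those in the first direction arise
by pushing towers over black squares of a checkerboard. -/
theorem exists_towers (h : Surf p q r) (hX : LineX q r j₀ k₀) (hY : LineY p r i₁ k₁)
    (hZ : LineZ p q i₂ j₂) : ∃ t : ℤ → ℤ → Prop,
      (∀ j k, t j k → (p 0 j₀ k₀ + j₀ + k₀ + j + k) % 2 = 1) ∧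
      (∀ j k, (t j k ∨ t j (k - 1)) ↔ (r i₂ j k + r i₂ j₂ 0 + j + j₂) % 2 = 1) ∧
      (∀ j k, (t j k ∨ t (j - 1) k) ↔ (q i₁ j k + q i₁ 0 k₁ + k + k₁) % 2 = 1) := by
  have black := fun j k => h.black_even hX hY hZ (j := j) (k := k)
  have white := fun j k => h.white_of_ne hX hY hZ (j := j) (k := k)
  have white' := fun j k => h.white_of_ne' hX hY hZ (j := j) (k := k)
  -- A tower stands on each black square with a deviation. Of two adjacent squares exactly one is
  -- black, and deviations do not change across it.
  refine ⟨fun j k => (p 0 j₀ k₀ + j₀ + k₀ + j + k) % 2 = 1 ∧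
    (r i₂ j k + r i₂ j₂ 0 + j + j₂) % 2 = 1, fun j k ht => ht.1, fun j k => ?_, fun j k => ?_⟩ <;>
    beta_reduce
  · have := white' j (k - 1)
    simp only [sub_add_cancel] at this
    by_cases hb : (p 0 j₀ k₀ + j₀ + k₀ + j + k) % 2 = 1
    · omega
    · have e : r i₂ j (k - 1) = r i₂ j k := by
        by_contra hne
        have := this hne
        omega
      rw [e]
      omega
  · have := white (j - 1) k
    simp only [sub_add_cancel] at this
    have b := black j k
    have b' := black (j - 1) k
    by_cases hb : (p 0 j₀ k₀ + j₀ + k₀ + j + k) % 2 = 1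
    · have := b hb
      omega
    · have e : q i₁ (j - 1) k = q i₁ j k := by
        by_contra hne
        have := this hne
        omega
      have := b' (by omega)
      rw [e] at this
      omega

end Surf

/-! ### Pushing towers in coordinates -/

open Classical in
/-- The indicator of a face, flipped where `t` holds. -/
noncomputable def tog (t : Prop) (a : ℤ) : ℤ := if t then 1 - a else a

theorem tog_of {t : Prop} (h : t) (a : ℤ) : tog t a = 1 - a := if_pos h

theorem tog_of_not {t : Prop} (h : ¬ t) (a : ℤ) : tog t a = a := if_neg h

theorem tog_tog (t : Prop) (a : ℤ) : tog t (tog t a) = a := by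
  by_cases h : t
  · rw [tog_of h, tog_of h, sub_sub_cancel]
  · rw [tog_of_not h, tog_of_not h]

theorem tog_bounds (t : Prop) {a : ℤ} (h : 0 ≤ a ∧ a ≤ 1) : 0 ≤ tog t a ∧ tog t a ≤ 1 := by
  by_cases ht : t
  · rw [tog_of ht]
    omega
  · rwa [tog_of_not ht]

theorem tog_add_tog (t : Prop) {a b : ℤ} (h : a + b = 1) : tog t a + tog t b = 1 := by
  by_cases ht : t
  · rw [tog_of ht, tog_of ht]
    omega
  · rwa [tog_of_not ht, tog_of_not ht]

/-- A tower along the first axis over the square `(j, k)`, in coordinates. -/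
structure XTower (p q r : ℤ → ℤ → ℤ → ℤ) (j k : ℤ) : Prop where
  mirror : ∀ i j' k', j - 1 ≤ j' → j' ≤ j + 1 → k - 1 ≤ k' → k' ≤ k + 1 → p i j' k' = p 0 j' k'
  q_alt : ∀ i j' k', j' = j ∨ j' = j + 1 → k - 1 ≤ k' → k' ≤ k + 1 →
    q (i - 1) j' k' + q i j' k' = 1
  r_alt : ∀ i j' k', k' = k ∨ k' = k + 1 → j - 1 ≤ j' → j' ≤ j + 1 →
    r (i - 1) j' k' + r i j' k' = 1
  face : p 0 j k = 1
  face_jm : p 0 (j - 1) k = 0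
  face_jp : p 0 (j + 1) k = 0
  face_km : p 0 j (k - 1) = 0
  face_kp : p 0 j (k + 1) = 0

theorem XTower.push {j k : ℤ} (h : XTower p q r j k) (s t : ℤ → ℤ → Prop) :
    XTower p (fun i j k => tog (s j k) (q i j k)) (fun i j k => tog (t j k) (r i j k)) j k where
  mirror := h.mirror
  q_alt i j' k' h1 h2 h3 := tog_add_tog _ (h.q_alt i j' k' h1 h2 h3)
  r_alt i j' k' h1 h2 h3 := tog_add_tog _ (h.r_alt i j' k' h1 h2 h3)
  face := h.face
  face_jm := h.face_jm
  face_jp := h.face_jp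
  face_km := h.face_km
  face_kp := h.face_kp

namespace Surf

/-- Pushing towers yields a cubic polyhedron. -/
theorem push (h : Surf p q r) {t : ℤ → ℤ → Prop} (ht : ∀ j k, t j k → XTower p q r j k) :
    Surf p (fun i j k => tog (t j k ∨ t (j - 1) k) (q i j k))
      (fun i j k => tog (t j k ∨ t j (k - 1)) (r i j k)) where
  p01 := h.p01
  q01 i j k := tog_bounds _ (h.q01 i j k)
  r01 i j k := tog_bounds _ (h.r01 i j k)
  vert i j k := by
    -- A tower on any of the four squares around the line `(j, k)` makes `p` a checkerboard on them.
    -- So only two diagonally opposite squares can carry towers at once.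
    have p11 : t j k → p i j k = 1 ∧ p i (j - 1) k = 0 ∧ p i j (k - 1) = 0 ∧
        p i (j - 1) (k - 1) = 1 := fun h1 => by
      have T := ht j k h1
      have := T.face
      have := T.face_jm
      have := T.face_km
      have := T.mirror i j k (by omega) (by omega) (by omega) (by omega)
      have := T.mirror i (j - 1) k (by omega) (by omega) (by omega) (by omega)
      have := T.mirror i j (k - 1) (by omega) (by omega) (by omega) (by omega)
      have := T.r_alt i (j - 1) k (by omega) (by omega) (by omega)
      have := (h.vert i j k).ym
      omega
    have p01 : t (j - 1) k → p i j k = 0 ∧ p i (j - 1) k = 1 ∧ p i j (k - 1) = 1 ∧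
        p i (j - 1) (k - 1) = 0 := fun h1 => by
      have T := ht (j - 1) k h1
      have := T.face
      have := T.face_jp
      have := T.face_km
      simp only [sub_add_cancel] at *
      have := T.mirror i j k (by omega) (by omega) (by omega) (by omega)
      have := T.mirror i (j - 1) k (by omega) (by omega) (by omega) (by omega)
      have := T.mirror i (j - 1) (k - 1) (by omega) (by omega) (by omega) (by omega)
      have := T.r_alt i j k (by omega) (by omega) (by omega)
      have := (h.vert i j k).yp
      omega
    have p10 : t j (k - 1) → p i j k = 0 ∧ p i (j - 1) k = 1 ∧ p i j (k - 1) = 1 ∧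
        p i (j - 1) (k - 1) = 0 := fun h1 => by
      have T := ht j (k - 1) h1
      have := T.face
      have := T.face_jm
      have := T.face_kp
      simp only [sub_add_cancel] at *
      have := T.mirror i j k (by omega) (by omega) (by omega) (by omega)
      have := T.mirror i j (k - 1) (by omega) (by omega) (by omega) (by omega)
      have := T.mirror i (j - 1) (k - 1) (by omega) (by omega) (by omega) (by omega)
      have := T.r_alt i (j - 1) k (by omega) (by omega) (by omega)
      have := (h.vert i j k).ym
      omega
    have p00 : t (j - 1) (k - 1) → p i j k = 1 ∧ p i (j - 1) k = 0 ∧ p i j (k - 1) = 0 ∧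
        p i (j - 1) (k - 1) = 1 := fun h1 => by
      have T := ht (j - 1) (k - 1) h1
      have := T.face
      have := T.face_jp
      have := T.face_kp
      simp only [sub_add_cancel] at *
      have := T.mirror i (j - 1) k (by omega) (by omega) (by omega) (by omega)
      have := T.mirror i j (k - 1) (by omega) (by omega) (by omega) (by omega)
      have := T.mirror i (j - 1) (k - 1) (by omega) (by omega) (by omega) (by omega)
      have := T.r_alt i j k (by omega) (by omega) (by omega)
      have := (h.vert i j k).yp
      omega
    obtain ⟨xp, xm, yp, ym, zp, zm, t0, t1, t2, t3, t4, t5, t6, t7⟩ := h.vert i j k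
    have := h.q01 i j k
    have := h.q01 (i - 1) j k
    have := h.q01 i j (k - 1)
    have := h.q01 (i - 1) j (k - 1)
    have := h.r01 i j k
    have := h.r01 (i - 1) j k
    have := h.r01 i (j - 1) k
    have := h.r01 (i - 1) (j - 1) k
    by_cases h11 : t j k <;> by_cases h01 : t (j - 1) k <;> by_cases h10 : t j (k - 1) <;>
      by_cases h00 : t (j - 1) (k - 1) <;>
      simp only [h11, h01, h10, h00, true_imp_iff, false_imp_iff, tog_of_not not_false,
        tog_of trivial, or_false, or_true] at * <;>
      first
      | omega
      | (constructor <;> omega)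

/-! ### No flange lines in the third direction -/

/-- Without z-flange lines `p` alternates in `j`, and without y-flange lines at level `k` it flips
from `k - 1` to `k`. One disagreement of consecutive planes would spread along both rows and turn
every x-line at level `k` into a flange line, against `hs`. -/
theorem mirror_of_no_lineY (h : Surf p q r) (hZ : ∀ i j, ¬ LineZ p q i j) {k : ℤ}
    (hs : ∃ j, ¬ LineX q r j k) (hY : ∀ i, ¬ LineY p r i k) (i i' j : ℤ) :
    p i j k = p i' j k ∧ p i j (k - 1) = p i' j (k - 1) := by
  have key : ∀ i j, p (i + 1) j k = p i j k := by
    intro i j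
    by_contra hne
    have sh : ∀ m, p i m k ≠ p (i + 1) m k ∧ p i m (k - 1) ≠ p (i + 1) m (k - 1) := by
      intro m
      have := h.parity_x_j (hZ i) j m k
      have := h.parity_x_j (hZ (i + 1)) j m k
      have := (h.add_of_not_lineY (hY i) m).2
      have := (h.add_of_not_lineY (hY (i + 1)) m).2
      have := h.p01 i j k
      have := h.p01 (i + 1) j k
      have := h.p01 i m k
      have := h.p01 (i + 1) m k
      omega
    obtain ⟨m, hm⟩ := hs
    exact hm (h.lineX_of_complementary (sh _).2 (sh _).1 (sh _).2 (sh _).1)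
  have e : p i j k = p i' j k :=
    int_forall_of_iff (Q := fun i => p i j k = p i' j k)
      (fun i => by have := key (i - 1) j; simp only [sub_add_cancel] at this; rw [this]) rfl i
  have := (h.add_of_not_lineY (hY i) j).2
  have := (h.add_of_not_lineY (hY i') j).2
  omega

/-- Without lines of flanges in the third direction and without slabs, pushing towers along the
first axis makes the planes normal to the second axis equal. -/
theorem exists_towers_of_no_lineZ (h : Surf p q r) (hZ : ∀ i j, ¬ LineZ p q i j)
    (hs : ∀ k, ∃ j, ¬ LineX q r j k) (hs' : ∀ k, ∃ i, ¬ LineY p r i k) :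
    ∃ t : ℤ → ℤ → Prop, (∀ j k, t j k → XTower p q r j k) ∧
      (∀ j k, t j k → (∃ m, LineX q r m k) ∧ ∃ m, LineX q r m (k + 1)) ∧
      ∀ i j k, tog (t j k ∨ t (j - 1) k) (q i j k) = q i 0 k := by
  have black : ∀ i j k, (∃ m, LineX q r m k) → p i j k = 1 → q i j k = q i (j + 1) k := by
    rintro i j k ⟨m, hm⟩ hp
    by_contra hne
    -- Disagreement at `k - 1` too would make the planes complementary around `(i, k)`, since both
    -- flip in `i`. The resulting y-flange line would cross the x-flange line at level `k`.
    have he : q i j (k - 1) = q i (j + 1) (k - 1) := by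
      by_contra hne'
      refine h.not_lineY_of_lineX hm i
        (h.swapXY.lineX_of_complementary (i := j) (j := i) (k := k) ?_ ?_ hne' hne) <;>
      · have := (h.add_of_not_lineZ (hZ i j) k).1
        have := (h.add_of_not_lineZ (hZ i (j + 1)) k).1
        have := (h.add_of_not_lineZ (hZ i j) (k - 1)).1
        have := (h.add_of_not_lineZ (hZ i (j + 1)) (k - 1)).1
        omega
    have := (h.white_of_ne_of_eq hne he (hZ _ _) (hZ _ _)).1
    omega
  -- The plane with second coordinate 0 is the model. Towers stand on the faces where the plane at
  -- `j` differs from it, and only between levels that both contain x-flange lines.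
  refine ⟨fun j k => ((∃ m, LineX q r m k) ∧ ∃ m, LineX q r m (k + 1)) ∧ p 0 j k = 1 ∧
    q 0 j k ≠ q 0 0 k, ?_, fun j k ht => ht.1, ?_⟩
  · rintro j k ⟨⟨⟨m, hm⟩, ⟨m', hm'⟩⟩, hp, -⟩
    have nY := h.not_lineY_of_lineX hm
    have nY' := h.not_lineY_of_lineX hm'
    have z := fun i j => h.add_of_not_lineZ (hZ i j)
    have b0 := h.p01 0 j k
    have e := z 0 j k
    have e' := z 0 (j + 1) k
    have y := h.add_of_not_lineY (nY 0) j
    have y' := h.add_of_not_lineY (nY' 0) j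
    simp only [add_sub_cancel_right] at e' y'
    refine ⟨fun i j' k' _ _ h3 h4 => ?_, fun i j' k' _ _ _ => (z i j' k').1,
      fun i j' k' hk _ _ => ?_, hp, by omega, by omega, by omega, by omega⟩
    · have m1 := h.mirror_of_no_lineY hZ (hs _) nY i 0 j'
      have m2 := h.mirror_of_no_lineY hZ (hs _) nY' i 0 j'
      obtain rfl | rfl | rfl : k' = k - 1 ∨ k' = k ∨ k' = k + 1 := by omega
      · exact m1.2
      · exact m1.1
      · exact m2.1
    · obtain rfl | rfl := hk
      · exact (h.add_of_not_lineY (nY i) j').1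
      · exact (h.add_of_not_lineY (nY' i) j').1
  · intro i j k
    beta_reduce
    by_cases hk : (∃ m, LineX q r m k) ∧ ∃ m, LineX q r m (k + 1)
    · have b := black 0 j k hk.1
      have b' := black 0 (j - 1) k hk.1
      simp only [sub_add_cancel] at b'
      have e1 := h.parity_y_i (fun i => hZ i j) 0 i k
      have e2 := h.parity_y_i (fun i => hZ i 0) 0 i k
      have e3 := (h.add_of_not_lineZ (hZ 0 j) k).2
      have := h.p01 0 j k
      have := h.q01 0 j k
      have := h.q01 0 0 k
      have := h.q01 i j k
      have := h.q01 i 0 k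
      by_cases hq : q 0 j k = q 0 0 k
      · rw [tog_of_not]
        · omega
        · rintro (⟨-, h1, h2⟩ | ⟨-, h1, h2⟩)
          · exact h2 hq
          · exact h2 ((b' h1).trans hq)
      · rw [tog_of]
        · omega
        · by_cases hp : p 0 j k = 1
          · exact Or.inl ⟨hk, hp, hq⟩
          · have hp' : p 0 (j - 1) k = 1 := by omega
            exact Or.inr ⟨hk, hp', by rwa [b' hp']⟩
    -- One of the two levels bounding this strip has no x-flange line, so the planes already agree
    -- on the strip.
    · rw [tog_of_not (by tauto)]
      have hk' : (∀ m, ¬ LineX q r m k) ∨ ∀ m, ¬ LineX q r m (k + 1) := by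
        rw [not_and_or] at hk
        exact hk.imp (fun h m hm => h ⟨m, hm⟩) (fun h m hm => h ⟨m, hm⟩)
      have hZ' : ∀ j i, ¬ LineZ (fun i j k => q j i k) (fun i j k => p j i k) j i :=
        fun j i hz => hZ i j fun k => (hz k).symm
      rcases hk' with hk' | hk'
      · exact (h.swapXY.mirror_of_no_lineY hZ' (hs' _) hk' j 0 i).1
      · simpa using (h.swapXY.mirror_of_no_lineY hZ' (hs' _) hk' j 0 i).2

end Surf

/-! ### Sets of squares and their indicator functions -/

/-- Three pairwise distinct coordinate axes. -/
structure Axes (x y z : Fin 3) : Prop where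
  xy : x ≠ y
  yz : y ≠ z
  xz : x ≠ z

/-- The lattice point with coordinates `i`, `j`, `k` along the axes `x`, `y`, `z`. -/
def pt (x y _z : Fin 3) (i j k : ℤ) : Point :=
  fun a => if a = x then i else if a = y then j else k

/-- The distance from a vertex to the smallest corner of a square, along an axis along which
the square extends in direction `s`. -/
def off (s : ℤˣ) : ℤ := if s = 1 then 0 else -1

@[simp] theorem off_one : off 1 = 0 := rfl

@[simp] theorem off_neg_one : off (-1) = -1 := rfl

/-- The set of squares with given indicator functions. -/
def ofInd (x y z : Fin 3) (p q r : ℤ → ℤ → ℤ → ℤ) : Set Square :=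
  {g | (g.normal = x ∧ p (g.corner x) (g.corner y) (g.corner z) = 1) ∨
    (g.normal = y ∧ q (g.corner x) (g.corner y) (g.corner z) = 1) ∨
    (g.normal = z ∧ r (g.corner x) (g.corner y) (g.corner z) = 1)}

namespace Axes

variable {x y z : Fin 3}

theorem swapXY (ax : Axes x y z) : Axes y x z := ⟨ax.xy.symm, ax.xz, ax.yz⟩

theorem swapYZ (ax : Axes x y z) : Axes x z y := ⟨ax.xz, ax.yz.symm, ax.xy⟩

theorem swapXZ (ax : Axes x y z) : Axes z y x := ⟨ax.yz.symm, ax.xy.symm, ax.xz.symm⟩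

theorem eq_or (ax : Axes x y z) (a : Fin 3) : a = x ∨ a = y ∨ a = z := by
  obtain ⟨h1, h2, h3⟩ := ax
  omega

theorem forall_iff (ax : Axes x y z) {Q : Fin 3 → Prop} : (∀ a, Q a) ↔ Q x ∧ Q y ∧ Q z := by
  refine ⟨fun h => ⟨h _, h _, h _⟩, fun ⟨h1, h2, h3⟩ a => ?_⟩
  obtain rfl | rfl | rfl := ax.eq_or a
  exacts [h1, h2, h3]

theorem pt_x (_ax : Axes x y z) (i j k : ℤ) : pt x y z i j k x = i := if_pos rfl

theorem pt_y (ax : Axes x y z) (i j k : ℤ) : pt x y z i j k y = j := by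
  simp [pt, ax.xy.symm]

theorem pt_z (ax : Axes x y z) (i j k : ℤ) : pt x y z i j k z = k := by
  simp [pt, ax.xz.symm, ax.yz.symm]

theorem pt_self (ax : Axes x y z) (v : Point) : pt x y z (v x) (v y) (v z) = v := by
  funext a
  obtain rfl | rfl | rfl := ax.eq_or a
  · rw [ax.pt_x]
  · rw [ax.pt_y]
  · rw [ax.pt_z]

theorem exists_pt (ax : Axes x y z) (v : Point) : ∃ i j k, v = pt x y z i j k :=
  ⟨_, _, _, (ax.pt_self v).symm⟩

theorem pt_swapXY (ax : Axes x y z) (i j k : ℤ) : pt x y z i j k = pt y x z j i k := by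
  have := ax.swapXY.pt_self (pt x y z i j k)
  rw [ax.pt_x, ax.pt_y, ax.pt_z] at this
  exact this.symm

theorem pt_swapYZ (ax : Axes x y z) (i j k : ℤ) : pt x y z i j k = pt x z y i k j := by
  have := ax.swapYZ.pt_self (pt x y z i j k)
  rw [ax.pt_x, ax.pt_y, ax.pt_z] at this
  exact this.symm

theorem pt_add_vec_x (ax : Axes x y z) (i j k : ℤ) (s : ℤˣ) :
    pt x y z i j k + Dir.vec (x, s) = pt x y z (i + s) j k := by
  funext a
  obtain rfl | rfl | rfl := ax.eq_or a
  · simp [Dir.vec, ax.pt_x]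
  · simp [Dir.vec, ax.pt_y, ax.xy.symm]
  · simp [Dir.vec, ax.pt_z, ax.xz.symm]

theorem pt_add_vec_y (ax : Axes x y z) (i j k : ℤ) (s : ℤˣ) :
    pt x y z i j k + Dir.vec (y, s) = pt x y z i (j + s) k := by
  rw [ax.pt_swapXY, ax.swapXY.pt_add_vec_x, ax.pt_swapXY]

theorem pt_add_vec_z (ax : Axes x y z) (i j k : ℤ) (s : ℤˣ) :
    pt x y z i j k + Dir.vec (z, s) = pt x y z i j (k + s) := by
  rw [ax.pt_swapYZ, ax.swapYZ.pt_add_vec_y, ax.pt_swapYZ]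

theorem pt_add_unit_x (ax : Axes x y z) (i j k : ℤ) :
    pt x y z i j k + unit x = pt x y z (i + 1) j k :=
  ax.pt_add_vec_x i j k 1

theorem pt_mem_corners_x (ax : Axes x y z) {a b c i j k : ℤ} :
    pt x y z a b c ∈ (⟨pt x y z i j k, x⟩ : Square).corners ↔
      a = i ∧ (b = j ∨ b = j + 1) ∧ (c = k ∨ c = k + 1) := by
  simp [Square.corners, ax.forall_iff, ax.pt_x, ax.pt_y, ax.pt_z, ax.xy.symm, ax.xz.symm]

theorem pt_mem_corners_y (ax : Axes x y z) {a b c i j k : ℤ} :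
    pt x y z a b c ∈ (⟨pt x y z i j k, y⟩ : Square).corners ↔
      b = j ∧ (a = i ∨ a = i + 1) ∧ (c = k ∨ c = k + 1) := by
  rw [ax.pt_swapXY a, ax.pt_swapXY i, ax.swapXY.pt_mem_corners_x]

theorem pt_mem_corners_z (ax : Axes x y z) {a b c i j k : ℤ} :
    pt x y z a b c ∈ (⟨pt x y z i j k, z⟩ : Square).corners ↔
      c = k ∧ (a = i ∨ a = i + 1) ∧ (b = j ∨ b = j + 1) := by
  rw [ax.pt_swapYZ a, ax.pt_swapYZ i, ax.swapYZ.pt_mem_corners_y]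

theorem pt_mem_box (ax : Axes x y z) {a b c i j k : ℤ} :
    pt x y z a b c ∈ (⟨pt x y z i j k, x⟩ : Square).box ↔
      (b = j ∨ b = j + 1) ∧ (c = k ∨ c = k + 1) := by
  simp [Square.box, ax.forall_iff, ax.pt_x, ax.pt_y, ax.pt_z, ax.xy.symm, ax.xz.symm]

theorem ofInd_swapXY (x y z : Fin 3) (p q r : ℤ → ℤ → ℤ → ℤ) :
    ofInd x y z p q r =
      ofInd y x z (fun i j k => q j i k) (fun i j k => p j i k) (fun i j k => r j i k) := by
  ext g
  simp only [ofInd, Set.mem_ofPred_eq]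
  tauto

theorem ofInd_swapYZ (x y z : Fin 3) (p q r : ℤ → ℤ → ℤ → ℤ) :
    ofInd x y z p q r =
      ofInd x z y (fun i j k => p i k j) (fun i j k => r i k j) (fun i j k => q i k j) := by
  ext g
  simp only [ofInd, Set.mem_ofPred_eq]
  tauto

theorem mem_ofInd_x (ax : Axes x y z) {i j k : ℤ} :
    (⟨pt x y z i j k, x⟩ : Square) ∈ ofInd x y z p q r ↔ p i j k = 1 := by
  simp [ofInd, ax.xy, ax.xz, ax.pt_x, ax.pt_y, ax.pt_z]

theorem mem_ofInd_y (ax : Axes x y z) {i j k : ℤ} :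
    (⟨pt x y z i j k, y⟩ : Square) ∈ ofInd x y z p q r ↔ q i j k = 1 := by
  simp [ofInd, ax.xy.symm, ax.yz, ax.pt_x, ax.pt_y, ax.pt_z]

theorem mem_ofInd_z (ax : Axes x y z) {i j k : ℤ} :
    (⟨pt x y z i j k, z⟩ : Square) ∈ ofInd x y z p q r ↔ r i j k = 1 := by
  simp [ofInd, ax.xz.symm, ax.yz.symm, ax.pt_x, ax.pt_y, ax.pt_z]

theorem exists_ofInd (ax : Axes x y z) (P : Set Square) : ∃ p q r : ℤ → ℤ → ℤ → ℤ,
    (∀ i j k, (0 ≤ p i j k ∧ p i j k ≤ 1) ∧ (0 ≤ q i j k ∧ q i j k ≤ 1) ∧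
      (0 ≤ r i j k ∧ r i j k ≤ 1)) ∧ P = ofInd x y z p q r := by
  classical
  let f (n : Fin 3) (i j k : ℤ) : ℤ := if (⟨pt x y z i j k, n⟩ : Square) ∈ P then 1 else 0
  have hf : ∀ n i j k, 0 ≤ f n i j k ∧ f n i j k ≤ 1 := by
    intro n i j k
    by_cases h : (⟨pt x y z i j k, n⟩ : Square) ∈ P <;> simp [f, h]
  have hf' : ∀ n i j k, f n i j k = 1 ↔ (⟨pt x y z i j k, n⟩ : Square) ∈ P := by
    intro n i j k
    simp [f]
  refine ⟨f x, f y, f z, fun i j k => ⟨hf _ _ _ _, hf _ _ _ _, hf _ _ _ _⟩, ?_⟩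
  ext ⟨c, n⟩
  obtain ⟨i, j, k, rfl⟩ := ax.exists_pt c
  obtain rfl | rfl | rfl := ax.eq_or n
  · rw [ax.mem_ofInd_x, hf']
  · rw [ax.mem_ofInd_y, hf']
  · rw [ax.mem_ofInd_z, hf']

/-! ### Vertex figures in coordinates -/

theorem adj_self (ax : Axes x y z) (P : Set Square) (v : Point) (s t : ℤˣ) :
    ¬ (link P v).Adj (x, s) (x, t) := by
  rintro ⟨hne, ⟨c, n⟩, -, h1, h2, h3⟩
  obtain ⟨i, j, k, rfl⟩ := ax.exists_pt v
  obtain ⟨a, b, d, rfl⟩ := ax.exists_pt c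
  rw [ax.pt_add_vec_x] at h2 h3
  have hs := Int.units_eq_one_or s
  have ht := Int.units_eq_one_or t
  obtain rfl | rfl | rfl := ax.eq_or n
  · rw [ax.pt_mem_corners_x] at h1 h2 h3
    rcases hs with rfl | rfl <;> simp at h2 <;> omega
  · rw [ax.pt_mem_corners_y] at h1 h2 h3
    rcases hs with rfl | rfl <;> rcases ht with rfl | rfl <;> simp at hne h2 h3 <;> omega
  · rw [ax.pt_mem_corners_z] at h1 h2 h3
    rcases hs with rfl | rfl <;> rcases ht with rfl | rfl <;> simp at hne h2 h3 <;> omega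

theorem adj_xy (ax : Axes x y z) {i j k : ℤ} {s t : ℤˣ} :
    (link (ofInd x y z p q r) (pt x y z i j k)).Adj (x, s) (y, t) ↔
      r (i + off s) (j + off t) k = 1 := by
  have hs := Int.units_eq_one_or s
  have ht := Int.units_eq_one_or t
  constructor
  · rintro ⟨-, ⟨c, n⟩, hf, h1, h2, h3⟩
    obtain ⟨a, b, d, rfl⟩ := ax.exists_pt c
    rw [ax.pt_add_vec_x] at h2
    rw [ax.pt_add_vec_y] at h3
    obtain rfl | rfl | rfl := ax.eq_or n
    · rw [ax.pt_mem_corners_x] at h1 h2 h3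
      rcases hs with rfl | rfl <;> simp at h2 <;> omega
    · rw [ax.pt_mem_corners_y] at h1 h2 h3
      rcases ht with rfl | rfl <;> simp at h3 <;> omega
    · rw [ax.pt_mem_corners_z] at h1 h2 h3
      rw [ax.mem_ofInd_z] at hf
      have e1 : a = i + off s := by
        rcases hs with rfl | rfl <;> simp at h2 ⊢ <;> omega
      have e2 : b = j + off t := by
        rcases ht with rfl | rfl <;> simp at h3 ⊢ <;> omega
      rw [← e1, ← e2, h1.1]
      exact hf
  · intro hr
    refine ⟨fun e => ax.xy (congrArg Prod.fst e), ⟨pt x y z (i + off s) (j + off t) k, z⟩,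
      ax.mem_ofInd_z.2 hr, ?_, ?_, ?_⟩
    · rw [ax.pt_mem_corners_z]
      rcases hs with rfl | rfl <;> rcases ht with rfl | rfl <;> simp
    · rw [ax.pt_add_vec_x, ax.pt_mem_corners_z]
      rcases hs with rfl | rfl <;> rcases ht with rfl | rfl <;> simp
    · rw [ax.pt_add_vec_y, ax.pt_mem_corners_z]
      rcases hs with rfl | rfl <;> rcases ht with rfl | rfl <;> simp

theorem adj_xz (ax : Axes x y z) {i j k : ℤ} {s t : ℤˣ} :
    (link (ofInd x y z p q r) (pt x y z i j k)).Adj (x, s) (z, t) ↔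
      q (i + off s) j (k + off t) = 1 := by
  rw [ofInd_swapYZ, ax.pt_swapYZ, ax.swapYZ.adj_xy]

theorem adj_yz (ax : Axes x y z) {i j k : ℤ} {s t : ℤˣ} :
    (link (ofInd x y z p q r) (pt x y z i j k)).Adj (y, s) (z, t) ↔
      p i (j + off s) (k + off t) = 1 := by
  rw [ofInd_swapXY, ax.pt_swapXY, ax.swapXY.adj_xz]

theorem adj_yx (ax : Axes x y z) {i j k : ℤ} {s t : ℤˣ} :
    (link (ofInd x y z p q r) (pt x y z i j k)).Adj (y, s) (x, t) ↔
      r (i + off t) (j + off s) k = 1 := by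
  rw [SimpleGraph.adj_comm, ax.adj_xy]

theorem adj_zx (ax : Axes x y z) {i j k : ℤ} {s t : ℤˣ} :
    (link (ofInd x y z p q r) (pt x y z i j k)).Adj (z, s) (x, t) ↔
      q (i + off t) j (k + off s) = 1 := by
  rw [SimpleGraph.adj_comm, ax.adj_xz]

theorem adj_zy (ax : Axes x y z) {i j k : ℤ} {s t : ℤˣ} :
    (link (ofInd x y z p q r) (pt x y z i j k)).Adj (z, s) (y, t) ↔
      p i (j + off t) (k + off s) = 1 := by
  rw [SimpleGraph.adj_comm, ax.adj_yz]

/-- The reflection keeps the squares between the two vertices and exchanges those starting at `i +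
1` with those starting at `i - 1`. -/
theorem mirrored_x (ax : Axes x y z) {i j k : ℤ}
    (hp : ∀ s t, p (i + 1) (j + off s) (k + off t) = p i (j + off s) (k + off t))
    (hq : ∀ s, q (i + 1) j (k + off s) = q (i - 1) j (k + off s))
    (hr : ∀ s, r (i + 1) (j + off s) k = r (i - 1) (j + off s) k) :
    IsMirrored (ofInd x y z p q r) x (pt x y z i j k) := by
  have hq' : ∀ s t, q (i + 1 + off s) j (k + off t) = q (i + off (-s)) j (k + off t) := by
    intro s t
    rcases Int.units_eq_one_or s with rfl | rfl
    · simpa [sub_eq_add_neg] using hq t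
    · simp
  have hr' : ∀ s t, r (i + 1 + off s) (j + off t) k = r (i + off (-s)) (j + off t) k := by
    intro s t
    rcases Int.units_eq_one_or s with rfl | rfl
    · simpa [sub_eq_add_neg] using hr t
    · simp
  have hx : ∀ s, Dir.refl x (x, s) = (x, -s) := fun s => if_pos rfl
  have hy : ∀ s, Dir.refl x (y, s) = (y, s) := fun s => if_neg ax.xy.symm
  have hz : ∀ s, Dir.refl x (z, s) = (z, s) := fun s => if_neg ax.xz.symm
  rintro ⟨a, s⟩ ⟨b, t⟩
  rw [ax.pt_add_unit_x]
  obtain rfl | rfl | rfl := ax.eq_or a <;> obtain rfl | rfl | rfl := ax.eq_or b <;>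
    simp only [hx, hy, hz, ax.adj_self, ax.swapXY.adj_self, ax.swapXZ.adj_self, ax.adj_xy,
      ax.adj_xz, ax.adj_yz, ax.adj_yx, ax.adj_zx, ax.adj_zy, hp, hq', hr']

end Axes

/-! ### Single cycles and triangles in vertex figures -/

/-- Without triangles each component has at least four vertices: `v`, its two neighbours, and a
further neighbour of one of these. Two components do not fit. -/
theorem connected_of_two_neighbors {V : Type*} [Fintype V] [Nonempty V] (hV : Fintype.card V < 8)
    {G : SimpleGraph V} (h2 : ∀ v, (G.neighborSet v).ncard = 2)
    (h3 : ∀ a b c, G.Adj a b → G.Adj b c → ¬ G.Adj a c) : G.Connected := by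
  classical
  have four : ∀ v, 4 ≤ (Finset.univ.filter fun w => G.Reachable v w).card := by
    intro v
    obtain ⟨a, b, hab, hv⟩ := Set.ncard_eq_two.1 (h2 v)
    have ha : G.Adj v a := by
      rw [← SimpleGraph.mem_neighborSet, hv]
      exact Set.mem_insert _ _
    have hb : G.Adj v b := by
      rw [← SimpleGraph.mem_neighborSet, hv]
      exact Set.mem_insert_of_mem _ rfl
    obtain ⟨c, hc, hcv⟩ := Set.exists_ne_of_one_lt_ncard (by rw [h2 a]; norm_num :
      1 < (G.neighborSet a).ncard) v
    have hcb : c ≠ b := fun e => h3 v a b ha (e ▸ hc) hb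
    have hca : c ≠ a := fun e => G.loopless.irrefl a (e ▸ hc)
    have h : ({v, a, b, c} : Finset V) ⊆ Finset.univ.filter fun w => G.Reachable v w := by
      intro w hw
      simp only [Finset.mem_insert, Finset.mem_singleton] at hw
      simp only [Finset.mem_filter, Finset.mem_univ, true_and]
      rcases hw with rfl | rfl | rfl | rfl
      · exact SimpleGraph.Reachable.refl _
      · exact ha.reachable
      · exact hb.reachable
      · exact ha.reachable.trans (SimpleGraph.Adj.reachable hc)
    refine le_trans (le_of_eq ?_) (Finset.card_le_card h)
    rw [Finset.card_insert_of_notMem, Finset.card_insert_of_notMem, Finset.card_pair hcb.symm]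
    · simp [hab, hca.symm]
    · simp [ha.ne, hb.ne, hcv.symm]
  refine ⟨fun u v => ?_⟩
  by_contra huv
  have hd : Disjoint (Finset.univ.filter fun w => G.Reachable u w)
      (Finset.univ.filter fun w => G.Reachable v w) := by
    rw [Finset.disjoint_filter]
    exact fun w _ h1 h2 => huv (h1.trans h2.symm)
  have := Finset.card_le_univ ((Finset.univ.filter fun w => G.Reachable u w) ∪
    (Finset.univ.filter fun w => G.Reachable v w))
  rw [Finset.card_union_of_disjoint hd] at this
  have := four u
  have := four v
  omega

/-- The vertices of a triangle have no further neighbours, so it would be a whole component. -/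
theorem no_triangle_of_connected {V : Type*} [Fintype V] (hV : 3 < Fintype.card V)
    {G : SimpleGraph V} (h2 : ∀ v, (G.neighborSet v).ncard = 2) (hc : G.Connected) {a b c : V}
    (hab : G.Adj a b) (hbc : G.Adj b c) : ¬ G.Adj a c := by
  classical
  intro hac
  have nb : ∀ {u v w : V}, G.Adj u v → G.Adj u w → v ≠ w → ∀ t, G.Adj u t → t = v ∨ t = w := by
    intro u v w hv hw hne t ht
    by_contra hn
    push Not at hn
    have hs : (({v, w, t} : Finset V) : Set V) ⊆ G.neighborSet u := by
      intro m hm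
      simp only [Finset.coe_insert, Finset.coe_singleton, Set.mem_insert_iff,
        Set.mem_singleton_iff] at hm
      rcases hm with rfl | rfl | rfl
      exacts [hv, hw, ht]
    have := Set.ncard_le_ncard hs (Set.toFinite _)
    rw [Set.ncard_coe_finset, h2, Finset.card_insert_of_notMem, Finset.card_pair hn.2.symm] at this
    · omega
    · simp [hne, hn.1.symm]
  have closed : ∀ v, G.Reachable a v → v = a ∨ v = b ∨ v = c := by
    rintro v ⟨w⟩
    have : ∀ {u v : V}, G.Walk u v → (u = a ∨ u = b ∨ u = c) → (v = a ∨ v = b ∨ v = c) := by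
      intro u v w
      induction w with
      | nil => exact id
      | cons hadj _ ih =>
        intro hu
        apply ih
        rcases hu with rfl | rfl | rfl
        · exact Or.inr (nb hab hac hbc.ne _ hadj)
        · rcases nb hab.symm hbc hac.ne _ hadj with h | h <;> tauto
        · rcases nb hac.symm hbc.symm hab.ne _ hadj with h | h <;> tauto
    exact this w (Or.inl rfl)
  have : (Finset.univ : Finset V) ⊆ {a, b, c} := by
    intro v _
    simpa using closed v (hc.preconnected a v)
  have := (Finset.card_le_card this).trans Finset.card_le_three
  rw [Finset.card_univ] at this
  omega

/-! ### Geometric notions in coordinates -/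

namespace Axes

variable {x y z : Fin 3}

open Classical in
theorem ncard_dir (ax : Axes x y z) (S : Set Dir) : (S.ncard : ℤ) =
    ((if (x, 1) ∈ S then 1 else 0) + (if (x, -1) ∈ S then 1 else 0)) +
      (((if (y, 1) ∈ S then 1 else 0) + (if (y, -1) ∈ S then 1 else 0)) +
      ((if (z, 1) ∈ S then 1 else 0) + (if (z, -1) ∈ S then 1 else 0))) := by
  have hS : S = ↑(Finset.univ.filter (· ∈ S)) := by ext; simp
  have hu : (Finset.univ : Finset (Fin 3)) = {x, y, z} := by
    ext a
    simpa using ax.eq_or a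
  have h2 : ∀ f : ℤˣ → ℤ, ∑ s, f s = f 1 + f (-1) := fun f => by
    rw [(by decide : (Finset.univ : Finset ℤˣ) = {1, -1}), Finset.sum_pair (by decide)]
  conv_lhs => rw [hS]
  rw [Set.ncard_coe_finset, Finset.card_filter, Nat.cast_sum, Fintype.sum_prod_type, hu,
    Finset.sum_insert (by simp [ax.xy, ax.xz]), Finset.sum_pair ax.yz]
  simp only [h2, Nat.cast_ite, Nat.cast_one, Nat.cast_zero]

theorem ncard_x (ax : Axes x y z) (hq : ∀ i j k, 0 ≤ q i j k ∧ q i j k ≤ 1)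
    (hr : ∀ i j k, 0 ≤ r i j k ∧ r i j k ≤ 1) (i j k : ℤ) (s : ℤˣ) :
    (((link (ofInd x y z p q r) (pt x y z i j k)).neighborSet (x, s)).ncard : ℤ) =
      r (i + off s) (j - 1) k + r (i + off s) j k +
        (q (i + off s) j (k - 1) + q (i + off s) j k) := by
  have e : ∀ {a : ℤ}, 0 ≤ a ∧ a ≤ 1 → (if a = 1 then (1 : ℤ) else 0) = a := fun h => by
    split_ifs <;> omega
  rw [ax.ncard_dir]
  simp only [SimpleGraph.mem_neighborSet, ax.adj_self, ax.adj_xy, ax.adj_xz, e (hq _ _ _),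
    e (hr _ _ _), if_false, off_one, off_neg_one, add_zero, ← sub_eq_add_neg]
  ring

theorem two_faces_x (ax : Axes x y z) (hq : ∀ i j k, 0 ≤ q i j k ∧ q i j k ≤ 1)
    (hr : ∀ i j k, 0 ≤ r i j k ∧ r i j k ≤ 1) (i j k : ℤ) (s : ℤˣ) :
    ((link (ofInd x y z p q r) (pt x y z i j k)).neighborSet (x, s)).ncard = 2 ↔
      r (i + off s) (j - 1) k + r (i + off s) j k +
        (q (i + off s) j (k - 1) + q (i + off s) j k) = 2 := by
  rw [← ax.ncard_x hq hr i j k s]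
  norm_cast

theorem two_faces_y (ax : Axes x y z) (hp : ∀ i j k, 0 ≤ p i j k ∧ p i j k ≤ 1)
    (hr : ∀ i j k, 0 ≤ r i j k ∧ r i j k ≤ 1) (i j k : ℤ) (s : ℤˣ) :
    ((link (ofInd x y z p q r) (pt x y z i j k)).neighborSet (y, s)).ncard = 2 ↔
      r (i - 1) (j + off s) k + r i (j + off s) k +
        (p i (j + off s) (k - 1) + p i (j + off s) k) = 2 := by
  rw [ofInd_swapXY, ax.pt_swapXY]
  exact ax.swapXY.two_faces_x (fun _ _ _ => hp _ _ _) (fun _ _ _ => hr _ _ _) j i k s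

theorem two_faces_z (ax : Axes x y z) (hp : ∀ i j k, 0 ≤ p i j k ∧ p i j k ≤ 1)
    (hq : ∀ i j k, 0 ≤ q i j k ∧ q i j k ≤ 1) (i j k : ℤ) (s : ℤˣ) :
    ((link (ofInd x y z p q r) (pt x y z i j k)).neighborSet (z, s)).ncard = 2 ↔
      q (i - 1) j (k + off s) + q i j (k + off s) +
        (p i (j - 1) (k + off s) + p i j (k + off s)) = 2 := by
  rw [ofInd_swapYZ, ax.pt_swapYZ]
  exact ax.swapYZ.two_faces_y (fun _ _ _ => hp _ _ _) (fun _ _ _ => hq _ _ _) i k j s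

theorem card_dir : Fintype.card Dir = 6 := by
  simp [Fintype.card_prod, Fintype.card_units_int]

theorem surf_of_isCubicPolyhedron (ax : Axes x y z) (hp : ∀ i j k, 0 ≤ p i j k ∧ p i j k ≤ 1)
    (hq : ∀ i j k, 0 ≤ q i j k ∧ q i j k ≤ 1) (hr : ∀ i j k, 0 ≤ r i j k ∧ r i j k ≤ 1)
    (h : IsCubicPolyhedron (ofInd x y z p q r)) : Surf p q r where
  p01 := hp
  q01 := hq
  r01 := hr
  vert i j k := by
    have h2 := h.two_faces (pt x y z i j k)
    have dx := fun s => (ax.two_faces_x hq hr i j k s).1 (h2 _)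
    have dy := fun s => (ax.two_faces_y hp hr i j k s).1 (h2 _)
    have dz := fun s => (ax.two_faces_z hp hq i j k s).1 (h2 _)
    have tri : ∀ s t u, p i (j + off t) (k + off u) + q (i + off s) j (k + off u) +
        r (i + off s) (j + off t) k ≤ 2 := by
      intro s t u
      by_contra hn
      have := hp i (j + off t) (k + off u)
      have := hq (i + off s) j (k + off u)
      have := hr (i + off s) (j + off t) k
      exact no_triangle_of_connected (by rw [card_dir]; norm_num) h2 (h.link_connected _)
        (ax.adj_xy.2 (by omega : r (i + off s) (j + off t) k = 1))
        (ax.adj_yz.2 (by omega : p i (j + off t) (k + off u) = 1))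
        (ax.adj_xz.2 (by omega : q (i + off s) j (k + off u) = 1))
    have x1 := dx 1
    have x2 := dx (-1)
    have y1 := dy 1
    have y2 := dy (-1)
    have z1 := dz 1
    have z2 := dz (-1)
    have t1 := tri 1 1 1
    have t2 := tri 1 1 (-1)
    have t3 := tri 1 (-1) 1
    have t4 := tri 1 (-1) (-1)
    have t5 := tri (-1) 1 1
    have t6 := tri (-1) 1 (-1)
    have t7 := tri (-1) (-1) 1
    have t8 := tri (-1) (-1) (-1)
    simp only [off_one, off_neg_one, add_zero, ← sub_eq_add_neg] at *
    constructor <;> omega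

theorem isCubicPolyhedron_of_surf (ax : Axes x y z) (h : Surf p q r) :
    IsCubicPolyhedron (ofInd x y z p q r) := by
  have h2 : ∀ v d, ((link (ofInd x y z p q r) v).neighborSet d).ncard = 2 := by
    rintro v ⟨a, s⟩
    obtain ⟨i, j, k, rfl⟩ := ax.exists_pt v
    obtain ⟨xp, xm, yp, ym, zp, zm, -⟩ := h.vert i j k
    obtain rfl | rfl | rfl := ax.eq_or a
    · rw [ax.two_faces_x h.q01 h.r01]
      rcases Int.units_eq_one_or s with rfl | rfl <;>
        simp only [off_one, off_neg_one, add_zero, ← sub_eq_add_neg] <;> omega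
    · rw [ax.two_faces_y h.p01 h.r01]
      rcases Int.units_eq_one_or s with rfl | rfl <;>
        simp only [off_one, off_neg_one, add_zero, ← sub_eq_add_neg] <;> omega
    · rw [ax.two_faces_z h.p01 h.q01]
      rcases Int.units_eq_one_or s with rfl | rfl <;>
        simp only [off_one, off_neg_one, add_zero, ← sub_eq_add_neg] <;> omega
  refine ⟨h2, fun v => connected_of_two_neighbors (by rw [card_dir]; norm_num) (h2 v) ?_⟩
  obtain ⟨i, j, k, rfl⟩ := ax.exists_pt v
  have tri : ∀ s t u, r (i + off s) (j + off t) k = 1 → p i (j + off t) (k + off u) = 1 →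
      q (i + off s) j (k + off u) = 1 → False := by
    intro s t u
    obtain ⟨-, -, -, -, -, -, t0, t1, t2, t3, t4, t5, t6, t7⟩ := h.vert i j k
    rcases Int.units_eq_one_or s with rfl | rfl <;> rcases Int.units_eq_one_or t with rfl | rfl <;>
      rcases Int.units_eq_one_or u with rfl | rfl <;>
      simp only [off_one, off_neg_one, add_zero, ← sub_eq_add_neg] <;> omega
  rintro ⟨a, s⟩ ⟨b, t⟩ ⟨c, u⟩ h1 h2 h3
  obtain rfl | rfl | rfl := ax.eq_or a <;> obtain rfl | rfl | rfl := ax.eq_or b <;>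
    obtain rfl | rfl | rfl := ax.eq_or c <;>
    simp only [ax.adj_self, ax.swapXY.adj_self, ax.swapXZ.adj_self, ax.adj_xy,
      ax.adj_xz, ax.adj_yz, ax.adj_yx, ax.adj_zx, ax.adj_zy] at h1 h2 h3
  all_goals first
    | exact tri _ _ _ h1 h2 h3
    | exact tri _ _ _ h1 h3 h2
    | exact tri _ _ _ h2 h1 h3
    | exact tri _ _ _ h2 h3 h1
    | exact tri _ _ _ h3 h1 h2
    | exact tri _ _ _ h3 h2 h1

theorem isFlange_x (ax : Axes x y z) {i j k : ℤ} {s : ℤˣ} :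
    IsFlange (ofInd x y z p q r) (pt x y z i j k) (x, s) ↔
      (r (i + off s) (j - 1) k = 1 ∧ r (i + off s) j k = 1) ∨
        (q (i + off s) j (k - 1) = 1 ∧ q (i + off s) j k = 1) := by
  constructor
  · rintro ⟨⟨a, t⟩, h1, h2⟩
    simp only [Dir.opp] at h2
    obtain rfl | rfl | rfl := ax.eq_or a
    · exact absurd h1 (ax.adj_self _ _ _ _)
    · rw [ax.adj_xy] at h1 h2
      left
      rcases Int.units_eq_one_or t with rfl | rfl <;> simp_all [← sub_eq_add_neg]
    · rw [ax.adj_xz] at h1 h2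
      right
      rcases Int.units_eq_one_or t with rfl | rfl <;> simp_all [← sub_eq_add_neg]
  · rintro (⟨h1, h2⟩ | ⟨h1, h2⟩)
    · refine ⟨(y, 1), ax.adj_xy.2 (by simpa using h2), ax.adj_xy.2 ?_⟩
      simpa [← sub_eq_add_neg] using h1
    · refine ⟨(z, 1), ax.adj_xz.2 (by simpa using h2), ax.adj_xz.2 ?_⟩
      simpa [← sub_eq_add_neg] using h1

theorem isFlange_x_iff (ax : Axes x y z) (h : Surf p q r) {i j k : ℤ} {s : ℤˣ} :
    IsFlange (ofInd x y z p q r) (pt x y z i j k) (x, s) ↔ LineX q r j k := by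
  rw [ax.isFlange_x]
  constructor
  · rintro (⟨h1, h2⟩ | ⟨h1, h2⟩)
    · exact h.lineX_of_r (h1.trans h2.symm)
    · exact h.lineX_of_q (h1.trans h2.symm)
  · intro hX
    have h1 := hX (i + off s)
    have h2 := h.r_add_q_of_lineX hX (i + off s)
    have h3 := h.r01 (i + off s) j k
    omega

theorem isFlange_y_iff (ax : Axes x y z) (h : Surf p q r) {i j k : ℤ} {s : ℤˣ} :
    IsFlange (ofInd x y z p q r) (pt x y z i j k) (y, s) ↔ LineY p r i k := by
  rw [ofInd_swapXY, ax.pt_swapXY]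
  exact ax.swapXY.isFlange_x_iff h.swapXY

theorem isFlange_z_iff (ax : Axes x y z) (h : Surf p q r) {i j k : ℤ} {s : ℤˣ} :
    IsFlange (ofInd x y z p q r) (pt x y z i j k) (z, s) ↔ LineZ p q i j := by
  rw [ofInd_swapYZ, ax.pt_swapYZ]
  exact ax.swapYZ.isFlange_y_iff h.swapYZ

theorem isMonkeySaddle_of (ax : Axes x y z) (h : Surf p q r) {i j k : ℤ}
    (hX : ¬ LineX q r j k) (hY : ¬ LineY p r i k) (hZ : ¬ LineZ p q i j) :
    IsMonkeySaddle (ofInd x y z p q r) (pt x y z i j k) := by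
  rintro ⟨a, s⟩
  obtain rfl | rfl | rfl := ax.eq_or a
  · rwa [ax.isFlange_x_iff h]
  · rwa [ax.isFlange_y_iff h]
  · rwa [ax.isFlange_z_iff h]

theorem isScrew_x (ax : Axes x y z) (h : Surf p q r) {i j k : ℤ} (hX : LineX q r j k) :
    IsScrew (ofInd x y z p q r) (pt x y z i j k) x :=
  ⟨(ax.isFlange_x_iff h).2 hX, (ax.isFlange_x_iff h).2 hX⟩

theorem mirrored_y (ax : Axes x y z) {i j k : ℤ}
    (hq : ∀ s t, q (i + off s) (j + 1) (k + off t) = q (i + off s) j (k + off t))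
    (hp : ∀ s, p i (j + 1) (k + off s) = p i (j - 1) (k + off s))
    (hr : ∀ s, r (i + off s) (j + 1) k = r (i + off s) (j - 1) k) :
    IsMirrored (ofInd x y z p q r) y (pt x y z i j k) := by
  rw [ofInd_swapXY, ax.pt_swapXY]
  exact ax.swapXY.mirrored_x hq hp hr

theorem isTower_of (ax : Axes x y z) {j k : ℤ} (T : XTower p q r j k) :
    IsTower (ofInd x y z p q r) ⟨pt x y z 0 j k, x⟩ := by
  have hf := T.face
  have hjm := T.face_jm
  have hjp := T.face_jp
  have hkm := T.face_km
  have hkp := T.face_kp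
  refine ⟨⟨ax.mem_ofInd_x.2 hf, ?_⟩, ?_⟩
  · rintro v hv ⟨a, s⟩ hd
    obtain ⟨i, j', k', rfl⟩ := ax.exists_pt v
    rw [ax.pt_mem_corners_x] at hv
    obtain ⟨rfl, hj, hk⟩ := hv
    obtain rfl | rfl | rfl := ax.eq_or a
    · rw [ax.pt_add_vec_x, ax.pt_mem_corners_x] at hd
      rcases Int.units_eq_one_or s with rfl | rfl <;> simp at hd
    · rw [ax.pt_add_vec_y, ax.pt_mem_corners_x] at hd
      rw [ofInd_swapXY, ax.pt_swapXY, ax.swapXY.isFlange_x]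
      have e : j' + off s = j := by
        rcases Int.units_eq_one_or s with rfl | rfl <;> simp at hd ⊢ <;> omega
      have := T.r_alt 0 j k' hk (by omega) (by omega)
      rw [e]
      rcases hk with rfl | rfl
      · omega
      · rw [add_sub_cancel_right]
        omega
    · rw [ax.pt_add_vec_z, ax.pt_mem_corners_x] at hd
      rw [ofInd_swapYZ, ax.pt_swapYZ, ofInd_swapXY, ax.swapYZ.pt_swapXY,
        ax.swapYZ.swapXY.isFlange_x]
      have e : k' + off s = k := by
        rcases Int.units_eq_one_or s with rfl | rfl <;> simp at hd ⊢ <;> omega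
      have := T.q_alt 0 j' k hj (by omega) (by omega)
      rw [e]
      rcases hj with rfl | rfl
      · omega
      · rw [add_sub_cancel_right]
        omega
  · intro v hv
    obtain ⟨i, j', k', rfl⟩ := ax.exists_pt v
    rw [ax.pt_mem_box] at hv
    have ho : ∀ s, -1 ≤ off s ∧ off s ≤ 0 := fun s => by
      rcases Int.units_eq_one_or s with rfl | rfl <;> simp
    refine ax.mirrored_x (fun s t => ?_) (fun s => ?_) fun s => ?_
    · have := ho s
      have := ho t
      rw [T.mirror (i + 1) _ _ (by omega) (by omega) (by omega) (by omega),
        T.mirror i _ _ (by omega) (by omega) (by omega) (by omega)]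
    · have := ho s
      have h1 := T.q_alt i j' (k' + off s) hv.1 (by omega) (by omega)
      have h2 := T.q_alt (i + 1) j' (k' + off s) hv.1 (by omega) (by omega)
      rw [add_sub_cancel_right] at h2
      omega
    · have := ho s
      have h1 := T.r_alt i (j' + off s) k' hv.2 (by omega) (by omega)
      have h2 := T.r_alt (i + 1) (j' + off s) k' hv.2 (by omega) (by omega)
      rw [add_sub_cancel_right] at h2
      omega

theorem mem_sides_y (ax : Axes x y z) {a b c j k : ℤ} :
    (⟨pt x y z a b c, y⟩ : Square) ∈ (⟨pt x y z 0 j k, x⟩ : Square).sides ↔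
      (b = j ∨ b = j + 1) ∧ c = k := by
  constructor
  · rintro ⟨-, h⟩
    have h1 := h (ax.pt_mem_corners_y.2 ⟨rfl, Or.inl rfl, Or.inl rfl⟩)
    have h2 := h (ax.pt_mem_corners_y.2 ⟨rfl, Or.inl rfl, Or.inr rfl⟩)
    rw [ax.pt_mem_box] at h1 h2
    omega
  · rintro ⟨h1, rfl⟩
    refine ⟨ax.xy.symm, fun v hv => ?_⟩
    obtain ⟨i, j', k', rfl⟩ := ax.exists_pt v
    rw [ax.pt_mem_corners_y] at hv
    rw [ax.pt_mem_box]
    omega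

theorem mem_sides_z (ax : Axes x y z) {a b c j k : ℤ} :
    (⟨pt x y z a b c, z⟩ : Square) ∈ (⟨pt x y z 0 j k, x⟩ : Square).sides ↔
      b = j ∧ (c = k ∨ c = k + 1) := by
  rw [ax.pt_swapYZ a, ax.pt_swapYZ 0, ax.swapYZ.mem_sides_y, and_comm]

theorem symmDiff_iff_tog {t : Prop} {a : ℤ} (h : 0 ≤ a ∧ a ≤ 1) :
    (a = 1 ∧ ¬ t ∨ t ∧ ¬ a = 1) ↔ tog t a = 1 := by
  by_cases ht : t
  · rw [tog_of ht]
    simp only [ht, not_true_eq_false, and_false, true_and, false_or]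
    omega
  · rw [tog_of_not ht]
    simp [ht]

theorem isPushAlong_x (ax : Axes x y z) (hq : ∀ i j k, 0 ≤ q i j k ∧ q i j k ≤ 1)
    (hr : ∀ i j k, 0 ≤ r i j k ∧ r i j k ≤ 1) {t : ℤ → ℤ → Prop}
    (ht : ∀ j k, t j k → XTower p q r j k) :
    IsPushAlong x (ofInd x y z p q r)
      (ofInd x y z p (fun i j k => tog (t j k ∨ t (j - 1) k) (q i j k))
        (fun i j k => tog (t j k ∨ t j (k - 1)) (r i j k))) := by
  refine ⟨{f | ∃ j k, t j k ∧ f = ⟨pt x y z 0 j k, x⟩}, ?_, ?_⟩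
  · rintro _ ⟨j, k, h, rfl⟩
    exact ⟨rfl, ax.isTower_of (ht j k h)⟩
  · have hU : ∀ g : Square, (g ∈ ⋃ f ∈ {f | ∃ j k, t j k ∧ f = (⟨pt x y z 0 j k, x⟩ : Square)},
        f.sides) ↔ ∃ j k, t j k ∧ g ∈ (⟨pt x y z 0 j k, x⟩ : Square).sides := by
      intro g
      simp only [Set.mem_iUnion, exists_prop]
      constructor
      · rintro ⟨_, ⟨j, k, h, rfl⟩, hg⟩
        exact ⟨j, k, h, hg⟩
      · rintro ⟨j, k, h, hg⟩
        exact ⟨_, ⟨j, k, h, rfl⟩, hg⟩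
    ext ⟨v, n⟩
    obtain ⟨a, b, c, rfl⟩ := ax.exists_pt v
    rw [Set.mem_symmDiff, hU]
    obtain rfl | rfl | rfl := ax.eq_or n
    · have : ¬ ∃ j k, t j k ∧ (⟨pt n y z a b c, n⟩ : Square) ∈
          (⟨pt n y z 0 j k, n⟩ : Square).sides := by
        rintro ⟨j, k, -, h, -⟩
        exact h rfl
      rw [ax.mem_ofInd_x, ax.mem_ofInd_x]
      simp only [this, not_false_eq_true, and_true, false_and, or_false]
    · rw [ax.mem_ofInd_y, ax.mem_ofInd_y, ← symmDiff_iff_tog (hq a b c)]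
      have : (∃ j k, t j k ∧ (⟨pt x n z a b c, n⟩ : Square) ∈
          (⟨pt x n z 0 j k, x⟩ : Square).sides) ↔ (t b c ∨ t (b - 1) c) := by
        simp only [ax.mem_sides_y]
        constructor
        · rintro ⟨j, k, h, rfl | rfl, rfl⟩
          · exact Or.inl h
          · exact Or.inr (by simpa using h)
        · rintro (h | h)
          · exact ⟨_, _, h, Or.inl rfl, rfl⟩
          · exact ⟨_, _, h, Or.inr (by simp), rfl⟩
      rw [this]
    · rw [ax.mem_ofInd_z, ax.mem_ofInd_z, ← symmDiff_iff_tog (hr a b c)]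
      have : (∃ j k, t j k ∧ (⟨pt x y n a b c, n⟩ : Square) ∈
          (⟨pt x y n 0 j k, x⟩ : Square).sides) ↔ (t b c ∨ t b (c - 1)) := by
        simp only [ax.mem_sides_z]
        constructor
        · rintro ⟨j, k, h, rfl, rfl | rfl⟩
          · exact Or.inl h
          · exact Or.inr (by simpa using h)
        · rintro (h | h)
          · exact ⟨_, _, h, rfl, Or.inl rfl⟩
          · exact ⟨_, _, h, rfl, Or.inr (by simp)⟩
      rw [this]

theorem isPushAlong_y (ax : Axes x y z) (hp : ∀ i j k, 0 ≤ p i j k ∧ p i j k ≤ 1)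
    (hr : ∀ i j k, 0 ≤ r i j k ∧ r i j k ≤ 1) {t : ℤ → ℤ → Prop}
    (ht : ∀ i k, t i k → XTower (fun i j k => q j i k) (fun i j k => p j i k)
      (fun i j k => r j i k) i k) :
    IsPushAlong y (ofInd x y z p q r)
      (ofInd x y z (fun i j k => tog (t i k ∨ t (i - 1) k) (p i j k)) q
        (fun i j k => tog (t i k ∨ t i (k - 1)) (r i j k))) := by
  rw [ofInd_swapXY x y z p, ofInd_swapXY x y z]
  exact ax.swapXY.isPushAlong_x (fun _ _ _ => hp _ _ _) (fun _ _ _ => hr _ _ _) ht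

theorem isPushAlong_z (ax : Axes x y z) (hp : ∀ i j k, 0 ≤ p i j k ∧ p i j k ≤ 1)
    (hq : ∀ i j k, 0 ≤ q i j k ∧ q i j k ≤ 1) {t : ℤ → ℤ → Prop}
    (ht : ∀ i j, t i j → XTower (fun i j k => r j k i) (fun i j k => p j k i)
      (fun i j k => q j k i) i j) :
    IsPushAlong z (ofInd x y z p q r)
      (ofInd x y z (fun i j k => tog (t i j ∨ t (i - 1) j) (p i j k))
        (fun i j k => tog (t i j ∨ t i (j - 1)) (q i j k)) r) := by
  rw [ofInd_swapYZ x y z p, ofInd_swapYZ x y z]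
  exact ax.swapYZ.isPushAlong_y (fun _ _ _ => hp _ _ _) (fun _ _ _ => hq _ _ _) ht

/-- If all x-lines at level `k` were flange lines, they would form a slab. For the reflections along
y: `r` is constant in `j` at that level, hence so is `q` on both sides of it, and `p` alternates in
`j` since no z-flange line can cross. -/
theorem exists_not_lineX (ax : Axes x y z) (h : Surf p q r)
    (hs : ∀ n a c, ¬ IsSlab (ofInd x y z p q r) n a c) (k : ℤ) : ∃ j, ¬ LineX q r j k := by
  by_contra hc
  push Not at hc
  refine hs z x k ⟨ax.xz.symm, fun v hv => ?_⟩
  obtain ⟨i, j, k', rfl⟩ := ax.exists_pt v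
  rw [ax.pt_z] at hv
  subst hv
  refine ⟨ax.isScrew_x h (hc j), fun b hbz hbx => ?_⟩
  obtain rfl : b = y := (ax.eq_or b).elim (absurd · hbx) (·.resolve_right hbz)
  have hZ : ∀ i j, ¬ LineZ p q i j := fun i j => h.not_lineZ_of_lineX (hc j) i
  have hY : ∀ i, ¬ LineY p r i k' := h.not_lineY_of_lineX (hc 0)
  refine ax.mirrored_y (fun s t => ?_) (fun s => ?_) fun s => ?_
  · have e : ∀ i, q i (j + 1) k' = q i j k' ∧ q i (j + 1) (k' - 1) = q i j (k' - 1) := by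
      intro i
      have := h.r_add_q_of_lineX (hc j) i
      have := h.r_add_q_of_lineX (hc (j + 1)) i
      have := hc j i
      have := hc (j + 1) i
      simp only [add_sub_cancel_right] at *
      omega
    rcases Int.units_eq_one_or t with rfl | rfl
    · simpa using (e _).1
    · simpa [← sub_eq_add_neg] using (e _).2
  · have h1 := (h.add_of_not_lineZ (hZ i j) (k' + off s)).2
    have h2 := (h.add_of_not_lineZ (hZ i (j + 1)) (k' + off s)).2
    simp only [add_sub_cancel_right] at h2
    omega
  · have h1 := (hc j (i + off s)).1
    have h2 := (hc (j + 1) (i + off s)).1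
    simp only [add_sub_cancel_right] at h2
    omega

/-- As `q` does not depend on `j`, one x-flange line at level `k` makes all x-lines there flange
lines; likewise for y. The mirror conditions follow from alternation or constancy of `r`. -/
theorem isSheet_or_isUntwistedSlab (ax : Axes x y z) (h : Surf p q r)
    (hp : ∀ i j k, p i j k = p 0 j k) (hq : ∀ i j k, q i j k = q i 0 k)
    (hZ : ∀ i j, ¬ LineZ p q i j) (k : ℤ) :
    IsSheet (ofInd x y z p q r) z k ∨ IsUntwistedSlab (ofInd x y z p q r) z x k ∨
      IsUntwistedSlab (ofInd x y z p q r) z y k := by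
  have hX : (∃ j, LineX q r j k) → ∀ j, LineX q r j k := by
    rintro ⟨j, hj⟩ j'
    refine h.lineX_of_q (i := 0) ?_
    rw [hq 0 j', hq 0 j', ← hq 0 j, ← hq 0 j]
    exact (hj 0).2
  have hY : (∃ i, LineY p r i k) → ∀ i, LineY p r i k := by
    rintro ⟨i, hi⟩ i'
    refine h.lineY_of_p (j := 0) ?_
    rw [hp i', hp i', ← hp i, ← hp i]
    exact (hi 0).2
  have z1 := fun i j => h.add_of_not_lineZ (hZ i j)
  have mx : ∀ i j, (∀ s, r (i + 1) (j + off s) k = r (i - 1) (j + off s) k) →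
      IsMirrored (ofInd x y z p q r) x (pt x y z i j k) := fun i j hr => by
    refine ax.mirrored_x (fun s t => by rw [hp, hp i]) (fun s => ?_) hr
    have h1 := (z1 i j (k + off s)).1
    have h2 := (z1 (i + 1) j (k + off s)).1
    rw [add_sub_cancel_right] at h2
    omega
  have my : ∀ i j, (∀ s, r (i + off s) (j + 1) k = r (i + off s) (j - 1) k) →
      IsMirrored (ofInd x y z p q r) y (pt x y z i j k) := fun i j hr => by
    refine ax.mirrored_y (fun s t => by rw [hq, hq _ j]) (fun s => ?_) hr
    have h1 := (z1 i j (k + off s)).2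
    have h2 := (z1 i (j + 1) (k + off s)).2
    rw [add_sub_cancel_right] at h2
    omega
  have alt_i : ∀ i, ¬ LineY p r i k → ¬ LineY p r (i + 1) k → ∀ j, r (i + 1) j k = r (i - 1) j k :=
    fun i h1 h2 j => by
      have h1 := (h.add_of_not_lineY h1 j).1
      have h2 := (h.add_of_not_lineY h2 j).1
      rw [add_sub_cancel_right] at h2
      omega
  have line_i : ∀ i, LineY p r i k → LineY p r (i + 1) k → ∀ j, r (i + 1) j k = r (i - 1) j k :=
    fun i h1 h2 j => by
      have h1 := (h1 j).1
      have h2 := (h2 j).1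
      rw [add_sub_cancel_right] at h2
      omega
  have alt_j : ∀ j, ¬ LineX q r j k → ¬ LineX q r (j + 1) k → ∀ i, r i (j + 1) k = r i (j - 1) k :=
    fun j h1 h2 i => by
      have h1 := (h.add_of_not_lineX h1 i).1
      have h2 := (h.add_of_not_lineX h2 i).1
      rw [add_sub_cancel_right] at h2
      omega
  have line_j : ∀ j, LineX q r j k → LineX q r (j + 1) k → ∀ i, r i (j + 1) k = r i (j - 1) k :=
    fun j h1 h2 i => by
      have h1 := (h1 i).1
      have h2 := (h2 i).1
      rw [add_sub_cancel_right] at h2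
      omega
  by_cases lX : ∃ j, LineX q r j k
  · have lX := hX lX
    have nY := h.not_lineY_of_lineX (lX 0)
    refine Or.inr (Or.inl ⟨⟨ax.xz.symm, fun v hv => ?_⟩, fun v hv => ?_⟩) <;>
      obtain ⟨i, j, k', rfl⟩ := ax.exists_pt v <;> rw [ax.pt_z] at hv <;> subst hv
    · refine ⟨ax.isScrew_x h (lX j), fun b hbz hbx => ?_⟩
      obtain rfl : b = y := (ax.eq_or b).elim (absurd · hbx) (·.resolve_right hbz)
      exact my i j fun s => line_j j (lX _) (lX _) _
    · exact mx i j fun s => alt_i i (nY _) (nY _) _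
  by_cases lY : ∃ i, LineY p r i k
  · have lY := hY lY
    have nX : ∀ j, ¬ LineX q r j k := fun j hj => lX ⟨j, hj⟩
    refine Or.inr (Or.inr ⟨⟨ax.yz.symm, fun v hv => ?_⟩, fun v hv => ?_⟩) <;>
      obtain ⟨i, j, k', rfl⟩ := ax.exists_pt v <;> rw [ax.pt_z] at hv <;> subst hv
    · refine ⟨⟨(ax.isFlange_y_iff h).2 (lY i), (ax.isFlange_y_iff h).2 (lY i)⟩,
        fun b hbz hby => ?_⟩
      obtain rfl : b = x := (ax.eq_or b).resolve_right (by tauto)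
      exact mx i j fun s => line_i i (lY _) (lY _) _
    · exact my i j fun s => alt_j j (nX _) (nX _) _
  push Not at lX lY
  left
  intro v hv
  obtain ⟨i, j, k', rfl⟩ := ax.exists_pt v
  rw [ax.pt_z] at hv
  subst hv
  refine ⟨ax.isMonkeySaddle_of h (lX _) (lY _) (hZ _ _), fun b hb => ?_⟩
  obtain rfl | rfl : b = x ∨ b = y := by
    have := ax.eq_or b
    tauto
  · exact mx i j fun s => alt_i i (lY _) (lY _) _
  · exact my i j fun s => alt_j j (lX _) (lX _) _

/-- A cubic polyhedron without slabs and without screws in one direction. -/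
theorem isPushedPolyhedron_of_no_lineZ (ax : Axes x y z) (h : Surf p q r)
    (hs : ∀ n a c, ¬ IsSlab (ofInd x y z p q r) n a c) (hZ : ∀ i j, ¬ LineZ p q i j) :
    IsPushedPolyhedron (ofInd x y z p q r) := by
  have hsX := ax.exists_not_lineX h hs
  have hsY : ∀ k, ∃ i, ¬ LineY p r i k :=
    ax.swapXY.exists_not_lineX h.swapXY (by rwa [ofInd_swapXY] at hs)
  have hZ' : ∀ j i, ¬ LineZ (fun i j k => q j i k) (fun i j k => p j i k) j i :=
    fun j i hz => hZ i j fun k => (hz k).symm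
  obtain ⟨t, tT, tX, tq⟩ := h.exists_towers_of_no_lineZ hZ hsX hsY
  obtain ⟨u, uT, uY, up⟩ := h.swapXY.exists_towers_of_no_lineZ hZ' hsY hsX
  have hR := h.push tT
  -- The x-towers meet only levels with x-flange lines, which have no y-flange lines. So they leave
  -- alone the levels that the y-towers meet.
  have tY : ∀ i k, LineY p r i k → ∀ j, ¬ (t j k ∨ t j (k - 1)) := by
    rintro i k hY j (ht | ht)
    · obtain ⟨⟨m, hm⟩, -⟩ := tX _ _ ht
      exact h.not_lineY_of_lineX hm i hY
    · obtain ⟨-, m, hm⟩ := tX _ _ ht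
      rw [sub_add_cancel] at hm
      exact h.not_lineY_of_lineX hm i hY
  have uT' : ∀ i k, u i k → XTower (fun i j k => tog (t i k ∨ t (i - 1) k) (q j i k))
      (fun i j k => p j i k) (fun i j k => tog (t i k ∨ t i (k - 1)) (r j i k)) i k := by
    intro i k hu
    have T := uT i k hu
    have e : ∀ i k, tog (t 0 k ∨ t (0 - 1) k) (q i 0 k) = q i 0 k := fun i k => tq i 0 k
    refine ⟨fun j i' k' _ _ _ _ => (tq _ _ _).trans (tq _ _ _).symm, T.q_alt,
      fun j i' k' hk h1 h2 => ?_, (e _ _).trans T.face, (e _ _).trans T.face_jm,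
      (e _ _).trans T.face_jp, (e _ _).trans T.face_km, (e _ _).trans T.face_kp⟩
    obtain ⟨m, hm⟩ : ∃ m, LineY p r m k' := by
      rcases hk with rfl | rfl
      exacts [(uY _ _ hu).1, (uY _ _ hu).2]
    rw [tog_of_not (tY m k' hm _), tog_of_not (tY m k' hm _)]
    exact T.r_alt j i' k' hk h1 h2
  have hT := (hR.swapXY.push uT').swapXY
  -- A pushed tower is still a tower, and pushing it again restores the original faces. This
  -- reverses the path from the given polyhedron to `P_τ`.
  have uT'' := fun i k hu => (uT' i k hu).push (fun i k => u i k ∨ u (i - 1) k)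
    (fun i k => u i k ∨ u i (k - 1))
  have tT' := fun j k ht => (tT j k ht).push (fun j k => t j k ∨ t (j - 1) k)
    (fun j k => t j k ∨ t j (k - 1))
  have push1 := ax.isPushAlong_y hT.p01 hT.r01 uT''
  have push2 := ax.isPushAlong_x hR.q01 hR.r01 tT'
  simp only [tog_tog] at push1 push2
  have hZT : ∀ i j, ¬ LineZ (fun i j k => tog (u i k ∨ u (i - 1) k) (p i j k))
      (fun i j k => tog (t j k ∨ t (j - 1) k) (q i j k)) i j := by
    intro i j hz
    have h1 := (hz 0).2
    simp only [up] at h1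
    have := (h.add_of_not_lineZ (hZ 0 j) 0).2
    omega
  have layer := ax.isSheet_or_isUntwistedSlab hT (fun i j k => (up j i k).trans (up j 0 k).symm)
    (fun i j k => (tq i j k).trans (tq i 0 k).symm) hZT
  choose τ hτ using fun k => (show ∃ l : Letter, match l with
    | Letter.zero => IsSheet _ z k
    | Letter.x => IsUntwistedSlab _ z x k
    | Letter.y => IsUntwistedSlab _ z y k from by
      rcases layer k with hl | hl | hl
      exacts [⟨Letter.zero, hl⟩, ⟨Letter.x, hl⟩, ⟨Letter.y, hl⟩])
  exact ⟨x, y, z, ax.xy, ax.yz, ax.xz, Or.inr ⟨τ, _, _,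
    ⟨ax.isCubicPolyhedron_of_surf hT, hτ⟩, push1, push2⟩⟩

end Axes

/-! ### Assembling the pushes of `P_0` -/

variable {j₀ k₀ i₁ k₁ i₂ j₂ : ℤ}

theorem tog_parity {t : Prop} {b : ℤ} (h : t ↔ b % 2 = 1) (a : ℤ) : (tog t a + a + b) % 2 = 0 := by
  by_cases ht : t
  · rw [tog_of ht]
    have := h.1 ht
    omega
  · rw [tog_of_not ht]
    have := mt h.2 ht
    omega

/-- At a level without x-flange lines `r` alternates in `j`, so it has no deviation and no x-tower
can touch that level. -/
theorem Surf.exists_lineX_of_towers (h : Surf p q r) (hX : LineX q r j₀ k₀)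
    (hY : LineY p r i₁ k₁) (hZ : LineZ p q i₂ j₂) {t : ℤ → ℤ → Prop}
    (h1 : ∀ j k, (t j k ∨ t j (k - 1)) ↔ (r i₂ j k + r i₂ j₂ 0 + j + j₂) % 2 = 1)
    (h2 : ∀ j k, (t j k ∨ t (j - 1) k) ↔ (q i₁ j k + q i₁ 0 k₁ + k + k₁) % 2 = 1)
    {j k : ℤ} (ht : t j k) :
    (∀ k', k' = k ∨ k' = k + 1 → ∃ m, LineX q r m k') ∧
      ∀ j', j' = j ∨ j' = j + 1 → ∃ m, LineX q r j' m := by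
  constructor
  · intro k' hk'
    by_contra hn
    push Not at hn
    have e1 := h.parity_z_j hn i₂ j j₂
    have e2 := h.mirror_of_lineZ hX hY hZ k' 0
    have := (h1 j k').1 (by rcases hk' with rfl | rfl <;> simp [ht])
    omega
  · intro j' hj'
    by_contra hn
    push Not at hn
    have e1 := h.parity_y_k hn i₁ k k₁
    have e2 := h.mirror_of_lineY hX hY hZ j' 0
    have := (h2 j' k).1 (by rcases hj' with rfl | rfl <;> simp [ht])
    omega

/-- By `vanish_k` and `vanish_j`, the x-planes have no deviation in the strips next to an x-tower.
Hence towers along y and z pushed earlier leave the faces normal to x in these strips untouched. -/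
theorem Surf.vanish_of_towers (h : Surf p q r) (hX : LineX q r j₀ k₀)
    (hY : LineY p r i₁ k₁) (hZ : LineZ p q i₂ j₂) {t : ℤ → ℤ → Prop}
    (h1 : ∀ j k, (t j k ∨ t j (k - 1)) ↔ (r i₂ j k + r i₂ j₂ 0 + j + j₂) % 2 = 1)
    (h2 : ∀ j k, (t j k ∨ t (j - 1) k) ↔ (q i₁ j k + q i₁ 0 k₁ + k + k₁) % 2 = 1)
    {j k : ℤ} (ht : t j k) (i : ℤ) :
    (∀ k', k - 1 ≤ k' → k' ≤ k + 1 → (p i j₀ k' + p 0 j₀ k₀ + k' + k₀) % 2 = 0) ∧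
      ∀ j', j - 1 ≤ j' → j' ≤ j + 1 → (p i j' k₀ + p 0 j₀ k₀ + j' + j₀) % 2 = 0 := by
  obtain ⟨l1, l2⟩ := h.exists_lineX_of_towers hX hY hZ h1 h2 ht
  have m := h.mirror_of_lineX hX hY hZ i 0
  obtain ⟨a, ha⟩ := l1 k (Or.inl rfl)
  obtain ⟨b, hb⟩ := l1 (k + 1) (Or.inr rfl)
  obtain ⟨c, hc⟩ := l2 j (Or.inl rfl)
  obtain ⟨d, hd⟩ := l2 (j + 1) (Or.inr rfl)
  rw [← m]
  constructor
  · intro k' _ _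
    have e1 := h.vanish_k hX hY hZ ha i
    have e2 := h.vanish_k hX hY hZ hb i
    obtain rfl | rfl | rfl : k' = k - 1 ∨ k' = k ∨ k' = k + 1 := by omega
    exacts [e1.2, e1.1, e2.1]
  · intro j' _ _
    have e1 := h.vanish_j hX hY hZ hc i
    have e2 := h.vanish_j hX hY hZ hd i
    obtain rfl | rfl | rfl : j' = j - 1 ∨ j' = j ∨ j' = j + 1 := by omega
    exacts [e1.2, e1.1, e2.1]

/-- The polyhedron `P₀`, positioned by the parities of `a`, `b`, `c`. -/
theorem surf_checkerboard {a b c : ℤ} (h : (a + b + c) % 2 = 0) :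
    Surf (fun _ j k => (a + j + k) % 2) (fun i _ k => (b + i + k) % 2)
      (fun i j _ => (c + i + j) % 2) where
  p01 i j k := by omega
  q01 i j k := by omega
  r01 i j k := by omega
  vert i j k := by constructor <;> omega

theorem isPZero_checkerboard {x y z : Fin 3} (ax : Axes x y z) {a b c : ℤ}
    (h : (a + b + c) % 2 = 0) :
    IsPZero (ofInd x y z (fun _ j k => (a + j + k) % 2) (fun i _ k => (b + i + k) % 2)
      (fun i j _ => (c + i + j) % 2)) := by
  refine ⟨ax.isCubicPolyhedron_of_surf (surf_checkerboard h), fun v => ?_⟩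
  obtain ⟨i, j, k, rfl⟩ := ax.exists_pt v
  refine ax.isMonkeySaddle_of (surf_checkerboard h) ?_ ?_ ?_
  · intro hX
    have := (hX 0).1
    dsimp only at this
    omega
  · intro hY
    have := (hY 0).1
    dsimp only at this
    omega
  · intro hZ
    have := (hZ 0).1
    dsimp only at this
    omega

/-- A cubic polyhedron with screws in all three directions. -/
theorem Axes.isPushedPolyhedron_of_lines {x y z : Fin 3} (ax : Axes x y z) (h : Surf p q r)
    (hX : LineX q r j₀ k₀) (hY : LineY p r i₁ k₁) (hZ : LineZ p q i₂ j₂) :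
    IsPushedPolyhedron (ofInd x y z p q r) := by
  obtain ⟨t, tb, t1, t2⟩ := h.exists_towers hX hY hZ
  have hZy : LineZ (fun i j k => q j i k) (fun i j k => p j i k) j₂ i₂ := fun k => (hZ k).symm
  obtain ⟨u, ub, u1, u2⟩ := h.swapXY.exists_towers hY hX hZy
  have hY' : LineY (fun i j k => r j k i) (fun i j k => q j k i) k₀ j₀ := fun i => (hX i).symm
  have hZ' : LineZ (fun i j k => r j k i) (fun i j k => p j k i) k₁ i₁ := fun i => (hY i).symm
  obtain ⟨w, wb, w1, w2⟩ := h.swapYZ.swapXY.exists_towers hZ hY' hZ'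
  have sum := h.sum_even hX hY hZ
  have push1 := ax.isPushAlong_z (p := fun _ j k => (p 0 j₀ k₀ + j₀ + k₀ + j + k) % 2)
    (q := fun i _ k => (q i₁ 0 k₁ + i₁ + k₁ + i + k) % 2)
    (r := fun i j _ => (r i₂ j₂ 0 + i₂ + j₂ + i + j) % 2) (t := w)
    (fun _ _ _ => by omega) (fun _ _ _ => by omega) (fun i j hw => by
      have := wb i j hw
      constructor <;> intros <;> omega)
  have push2 := ax.isPushAlong_y (t := u)
    (p := fun i j k => tog (w i j ∨ w (i - 1) j) ((p 0 j₀ k₀ + j₀ + k₀ + j + k) % 2))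
    (q := fun i j k => tog (w i j ∨ w i (j - 1)) ((q i₁ 0 k₁ + i₁ + k₁ + i + k) % 2))
    (r := fun i j _ => (r i₂ j₂ 0 + i₂ + j₂ + i + j) % 2)
    (fun _ _ _ => tog_bounds _ (by omega)) (fun _ _ _ => by omega) (fun i k hu => by
      have b := ub i k hu
      obtain ⟨l1, l2⟩ := h.swapXY.exists_lineX_of_towers hY hX hZy u1 u2 hu
      have v := fun j => (h.swapXY.vanish_of_towers hY hX hZy u1 u2 hu j).2
      -- The squares relevant to this y-tower are not toggled by z-towers, so it is a tower after
      -- the first push.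
      have nw : ∀ j i', i - 1 ≤ i' → i' ≤ i + 1 → ¬ (w i' j ∨ w i' (j - 1)) := by
        intro j i' e1 e2 hw
        have := (w1 i' j).1 hw
        have := v j i' e1 e2
        omega
      have nw' : ∀ j i', i' = i ∨ i' = i + 1 → ¬ (w i' j ∨ w (i' - 1) j) := by
        intro j i' e hw
        obtain ⟨m, hm⟩ := l2 i' e
        have e1 := (w2 i' j).1 hw
        have e2 := h.parity_x_j (fun j => h.not_lineZ_of_lineY hm j) j j₀ k₀
        have e3 := h.mirror_of_lineX hX hY hZ i' 0
        omega
      refine ⟨fun j i' k' e1 e2 _ _ => ?_, fun j i' k' e _ _ => ?_, fun j i' k' _ _ _ => by omega,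
        ?_, ?_, ?_, ?_, ?_⟩
      · rw [tog_of_not (nw _ _ e1 e2), tog_of_not (nw _ _ e1 e2)]
      · rw [tog_of_not (nw' _ _ e), tog_of_not (nw' _ _ e)]
        omega
      all_goals
        rw [tog_of_not (nw _ _ (by omega) (by omega))]
        omega)
  have push3 := ax.isPushAlong_x (t := t)
    (p := fun i j k => tog (u i k ∨ u (i - 1) k)
      (tog (w i j ∨ w (i - 1) j) ((p 0 j₀ k₀ + j₀ + k₀ + j + k) % 2)))
    (q := fun i j k => tog (w i j ∨ w i (j - 1)) ((q i₁ 0 k₁ + i₁ + k₁ + i + k) % 2))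
    (r := fun i j k => tog (u i k ∨ u i (k - 1)) ((r i₂ j₂ 0 + i₂ + j₂ + i + j) % 2))
    (fun _ _ _ => tog_bounds _ (by omega)) (fun _ _ _ => tog_bounds _ (by omega))
    (fun j k ht => by
      have b := tb j k ht
      obtain ⟨l1, l2⟩ := h.exists_lineX_of_towers hX hY hZ t1 t2 ht
      have v := h.vanish_of_towers hX hY hZ t1 t2 ht
      -- Likewise neither y-towers nor z-towers toggle the squares relevant to this x-tower.
      have nu : ∀ i k', k - 1 ≤ k' → k' ≤ k + 1 → ¬ (u i k' ∨ u (i - 1) k') := by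
        intro i k' e1 e2 hu
        have := (u2 i k').1 hu
        have := (v i).1 k' e1 e2
        omega
      have nw : ∀ i j', j - 1 ≤ j' → j' ≤ j + 1 → ¬ (w i j' ∨ w (i - 1) j') := by
        intro i j' e1 e2 hw
        have := (w2 i j').1 hw
        have := (v i).2 j' e1 e2
        omega
      have nw' : ∀ i j', j' = j ∨ j' = j + 1 → ¬ (w i j' ∨ w i (j' - 1)) := by
        intro i j' e hw
        obtain ⟨m, hm⟩ := l2 j' e
        have e1 := (w1 i j').1 hw
        have e2 := h.parity_y_i (fun i => h.not_lineZ_of_lineX hm i) i i₁ k₁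
        have e3 := h.mirror_of_lineY hX hY hZ j' 0
        omega
      have nu' : ∀ i k', k' = k ∨ k' = k + 1 → ¬ (u i k' ∨ u i (k' - 1)) := by
        intro i k' e hu
        obtain ⟨m, hm⟩ := l1 k' e
        have e1 := (u1 i k').1 hu
        have e2 := h.parity_z_i (fun i => h.not_lineY_of_lineX hm i) i i₂ j₂
        have e3 := h.mirror_of_lineZ hX hY hZ k' 0
        omega
      refine ⟨fun i j' k' e1 e2 e3 e4 => ?_, fun i j' k' e _ _ => ?_, fun i j' k' e _ _ => ?_,
        ?_, ?_, ?_, ?_, ?_⟩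
      · rw [tog_of_not (nu _ _ e3 e4), tog_of_not (nu _ _ e3 e4), tog_of_not (nw _ _ e1 e2),
          tog_of_not (nw _ _ e1 e2)]
      · rw [tog_of_not (nw' _ _ e), tog_of_not (nw' _ _ e)]
        omega
      · rw [tog_of_not (nu' _ _ e), tog_of_not (nu' _ _ e)]
        omega
      all_goals
        rw [tog_of_not (nu _ _ (by omega) (by omega)), tog_of_not (nw _ _ (by omega) (by omega))]
        omega)
  refine ⟨x, y, z, ax.xy, ax.yz, ax.xz,
    Or.inl ⟨_, _, _, isPZero_checkerboard ax sum, push1, push2, ?_⟩⟩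
  -- By `plane_parity` each plane is its checkerboard plus one deviation in each direction, and
  -- these are the two toggles. Equal parities of numbers in {0, 1} give equality.
  convert push3 using 2
  · funext i j k
    have e1 := tog_parity (u2 i k)
      (tog (w i j ∨ w (i - 1) j) ((p 0 j₀ k₀ + j₀ + k₀ + j + k) % 2))
    have e2 := tog_parity (w2 i j) ((p 0 j₀ k₀ + j₀ + k₀ + j + k) % 2)
    have e3 := h.plane_parity i j j₀ k k₀
    have e4 := h.mirror_of_lineX hX hY hZ i 0
    have b1 := h.p01 i j k
    have b2 := tog_bounds (u i k ∨ u (i - 1) k) (tog_bounds (w i j ∨ w (i - 1) j)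
      (by omega : 0 ≤ (p 0 j₀ k₀ + j₀ + k₀ + j + k) % 2 ∧ (p 0 j₀ k₀ + j₀ + k₀ + j + k) % 2 ≤ 1))
    omega
  · funext i j k
    have e1 := tog_parity (t2 j k)
      (tog (w i j ∨ w i (j - 1)) ((q i₁ 0 k₁ + i₁ + k₁ + i + k) % 2))
    have e2 := tog_parity (w1 i j) ((q i₁ 0 k₁ + i₁ + k₁ + i + k) % 2)
    have e3 := h.swapXY.plane_parity j i i₁ k k₁
    have e4 := h.mirror_of_lineY hX hY hZ j 0
    have b1 := h.q01 i j k
    have b2 := tog_bounds (t j k ∨ t (j - 1) k) (tog_bounds (w i j ∨ w i (j - 1))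
      (by omega : 0 ≤ (q i₁ 0 k₁ + i₁ + k₁ + i + k) % 2 ∧ (q i₁ 0 k₁ + i₁ + k₁ + i + k) % 2 ≤ 1))
    omega
  · funext i j k
    have e1 := tog_parity (t1 j k)
      (tog (u i k ∨ u i (k - 1)) ((r i₂ j₂ 0 + i₂ + j₂ + i + j) % 2))
    have e2 := tog_parity (u1 i k) ((r i₂ j₂ 0 + i₂ + j₂ + i + j) % 2)
    have e3 := h.swapYZ.swapXY.plane_parity k i i₂ j j₂
    have e4 := h.mirror_of_lineZ hX hY hZ k 0
    have b1 := h.r01 i j k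
    have b2 := tog_bounds (t j k ∨ t j (k - 1)) (tog_bounds (u i k ∨ u i (k - 1))
      (by omega : 0 ≤ (r i₂ j₂ 0 + i₂ + j₂ + i + j) % 2 ∧ (r i₂ j₂ 0 + i₂ + j₂ + i + j) % 2 ≤ 1))
    omega

end CubicPolyhedra

theorem mainTheorem5 (P : Set CubicPolyhedra.Square)
    (hP : CubicPolyhedra.IsCubicPolyhedron P)
    (hslab : ∀ (n a : Fin 3) (c : ℤ), ¬ CubicPolyhedra.IsSlab P n a c) :
    CubicPolyhedra.IsPushedPolyhedron P := by
  have ax : CubicPolyhedra.Axes 0 1 2 := ⟨by decide, by decide, by decide⟩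
  obtain ⟨p, q, r, hb, rfl⟩ := ax.exists_ofInd P
  have h := ax.surf_of_isCubicPolyhedron (fun i j k => (hb i j k).1) (fun i j k => (hb i j k).2.1)
    (fun i j k => (hb i j k).2.2) hP
  -- A direction without flange lines is renamed to be the third one.
  by_cases hX : ∃ j k, CubicPolyhedra.LineX q r j k
  · by_cases hY : ∃ i k, CubicPolyhedra.LineY p r i k
    · by_cases hZ : ∃ i j, CubicPolyhedra.LineZ p q i j
      · obtain ⟨j₀, k₀, hX⟩ := hX
        obtain ⟨i₁, k₁, hY⟩ := hY
        obtain ⟨i₂, j₂, hZ⟩ := hZ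
        exact ax.isPushedPolyhedron_of_lines h hX hY hZ
      · push Not at hZ
        exact ax.isPushedPolyhedron_of_no_lineZ h hslab hZ
    · push Not at hY
      rw [CubicPolyhedra.Axes.ofInd_swapYZ] at hslab ⊢
      exact ax.swapYZ.isPushedPolyhedron_of_no_lineZ h.swapYZ hslab hY
  · push Not at hX
    rw [CubicPolyhedra.Axes.ofInd_swapXY, CubicPolyhedra.Axes.ofInd_swapYZ] at hslab ⊢
    exact ax.swapXY.swapYZ.isPushedPolyhedron_of_no_lineZ h.swapXY.swapYZ hslab
      fun i j hl => hX i j hl
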